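/- Let $M$ be a smooth manifold without boundary (Hausdorff and second countable) of dimension $2n\ge 6$, and let $\omega$ be a smooth pointwise non-degenerate $2$-form on $M$ (for example a symplectic form; closedness is not needed). Let $\pi\colon \mathrm{Gr}_2(TM)\to M$ be the bundle of oriented $2$-planes in $TM$. Call $P\in \mathrm{Gr}_2(TM)$ a symplectic $2$-plane if $\omega|_P$ is non-degenerate and the given orientation of $P$ is the one induced by $\omega|_P$ (that is, $\omega(a,b)>0$ for every oriented basis $(a,b)$ of $P$), and let $\mathrm{Gr}_2^{\mathrm{symp}}(TM)\subset \mathrm{Gr}_2(TM)$ be the subspace of symplectic $2$-planes. Let $$\mathrm{Sp}_2(M)=\{\gamma\colon[0,1]\to \mathrm{Gr}_2(TM)\text{ continuous} \mid \gamma(1)\in \mathrm{Gr}_2^{\mathrm{symp}}(TM)\text{ and }\pi\circ\gamma\text{ is constant}\}$$ with the compact-open topology, and let $\varepsilon\colon \mathrm{Sp}_2(M)\to \mathrm{Gr}_2(TM)$, $\varepsilon(\gamma)=\gamma(0)$. Then $\varepsilon$ is a Hurewicz fibration, and for every $P\in \mathrm{Gr}_2(TM)$ the fiber $\varepsilon^{-1}(P)$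 is $2$-connected (non-empty, with $\pi_i=0$ for all $i\le 2$ and all base points); in particular it is simply-connected. -/

import Mathlib

open scoped Manifold ContDiff Topology unitInterval
open Bundle

universe u v w

noncomputable section

/-- `X` is `k`-connected: it is non-empty and `π_i(X, x)` is trivial for all `i ≤ k` and all base
points `x` (for `i = 0` this says that `X` is path-connected). -/
def IsKConnected (k : ℕ) (X : Type u) [TopologicalSpace X] : Prop :=
  Nonempty X ∧ ∀ i : ℕ, i ≤ k → ∀ x : X, Subsingleton (π_ i X x)

/-- Hurewicz fibrations: continuous maps with the homotopy lifting property with respect to all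
topological spaces (here, all spaces in an arbitrary universe `w`). -/
def IsHurewiczFibration {X : Type u} {B : Type v} [TopologicalSpace X] [TopologicalSpace B]
    (p : X → B) : Prop :=
  Continuous p ∧
    ∀ (Y : Type w) [TopologicalSpace Y] (H : C(Y × I, B)) (f : C(Y, X)),
      (∀ y, p (f y) = H (y, 0)) →
        ∃ G : C(Y × I, X), (∀ y, G (y, 0) = f y) ∧ ∀ z, p (G z) = H z

section Grassmannian

variable (d : ℕ) (M : Type u) [TopologicalSpace M] [ChartedSpace (EuclideanSpace ℝ (Fin d)) M]

/-- The total space of the Whitney sum `TM ⊕ TM`: points of `M` with a pair of tangent vectors. -/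
abbrev TangentPairs : Type u :=
  TotalSpace (EuclideanSpace ℝ (Fin d) × EuclideanSpace ℝ (Fin d))
    ((TangentSpace (𝓡 d) : M → Type) ×ᵇ (TangentSpace (𝓡 d) : M → Type))

/-- The bundle of (non-compact) real `2`-frames of `TM`: pairs of linearly independent tangent
vectors at a common point, as a subspace of `TM ⊕ TM`. -/
abbrev TwoFrames : Type u :=
  {f : TangentPairs d M // LinearIndependent ℝ ![f.2.1, f.2.2]}

/-- Two `2`-frames span the same oriented plane iff they have the same base point and are related by
a matrix of positive determinant. -/
def SameOrientedPlane (f g : TwoFrames d M) : Prop :=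
  ∃ a b c e : ℝ, 0 < a * e - b * c ∧
    g.1 = ⟨f.1.1, (a • f.1.2.1 + b • f.1.2.2, c • f.1.2.1 + e • f.1.2.2)⟩

theorem sameOrientedPlane_equivalence : Equivalence (SameOrientedPlane d M) := by
  refine ⟨fun f ↦ ⟨1, 0, 0, 1, by norm_num, ?_⟩, ?_, ?_⟩
  · simp
  · rintro ⟨⟨x, v, w⟩, hf⟩ ⟨⟨y, v', w'⟩, hg⟩ ⟨a, b, c, e, hD, h⟩
    obtain ⟨rfl, h⟩ := TotalSpace.mk.inj h
    have h := eq_of_heq h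
    simp only [Prod.mk.injEq] at h
    obtain ⟨rfl, rfl⟩ := h
    obtain ⟨k, hk, key⟩ : ∃ k : ℝ, 0 < k ∧ (a * e - b * c) * k = 1 :=
      ⟨(a * e - b * c)⁻¹, inv_pos.2 hD, mul_inv_cancel₀ hD.ne'⟩
    refine ⟨e * k, -b * k, -c * k, a * k, ?_, ?_⟩
    · have : e * k * (a * k) - -b * k * (-c * k) = k := by linear_combination k * key
      rwa [this]
    · refine congrArg (TotalSpace.mk _) (Prod.ext ?_ ?_) <;> dsimp only <;> match_scalars <;>
        first | ring1 | linear_combination -key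
  · rintro ⟨⟨x, v, w⟩, hf⟩ ⟨⟨y, v', w'⟩, hg⟩ ⟨⟨z, v'', w''⟩, hh⟩ ⟨a, b, c, e, hD, h⟩
      ⟨a', b', c', e', hD', h'⟩
    obtain ⟨rfl, h⟩ := TotalSpace.mk.inj h
    obtain ⟨rfl, h'⟩ := TotalSpace.mk.inj h'
    have h := eq_of_heq h
    have h' := eq_of_heq h'
    simp only [Prod.mk.injEq] at h h'
    obtain ⟨rfl, rfl⟩ := h
    obtain ⟨rfl, rfl⟩ := h'
    refine ⟨a' * a + b' * c, a' * b + b' * e, c' * a + e' * c, c' * b + e' * e, ?_, ?_⟩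
    · have : (a' * a + b' * c) * (c' * b + e' * e) - (a' * b + b' * e) * (c' * a + e' * c)
          = (a' * e' - b' * c') * (a * e - b * c) := by ring
      rw [this]; positivity
    · refine congrArg (TotalSpace.mk _) (Prod.ext ?_ ?_) <;> dsimp only <;> module

/-- The setoid of `2`-frames spanning the same oriented plane. -/
def orientedPlaneSetoid : Setoid (TwoFrames d M) :=
  ⟨SameOrientedPlane d M, sameOrientedPlane_equivalence d M⟩

/-- `Gr₂(TM)`: the bundle of oriented `2`-planes in `TM`, i.e. `2`-frames modulo `GL₂⁺(ℝ)`. -/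
def OrientedGrassmannian : Type u := Quotient (orientedPlaneSetoid d M)

variable [IsManifold (𝓡 d) ∞ M]

/-- The quotient topology. -/
instance : TopologicalSpace (OrientedGrassmannian d M) :=
  inferInstanceAs (TopologicalSpace (Quotient (orientedPlaneSetoid d M)))

/-- A smooth pointwise non-degenerate `2`-form on `M`. Symplectic forms are exactly the closed
ones among these. -/
structure NondegenerateTwoForm where
  /-- the bilinear form on each tangent space -/
  form : ∀ x : M, TangentSpace (𝓡 d) x →L[ℝ] TangentSpace (𝓡 d) x →L[ℝ] ℝ
  alternating : ∀ (x : M) (a : TangentSpace (𝓡 d) x), form x a a = 0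
  nondegenerate : ∀ (x : M) (a : TangentSpace (𝓡 d) x), (∀ b, form x a b = 0) → a = 0
  smooth : ContMDiff (𝓡 d)
    ((𝓡 d).prod 𝓘(ℝ, EuclideanSpace ℝ (Fin d) →L[ℝ] EuclideanSpace ℝ (Fin d) →L[ℝ] ℝ)) ∞
    (fun x ↦ TotalSpace.mk' (EuclideanSpace ℝ (Fin d) →L[ℝ] EuclideanSpace ℝ (Fin d) →L[ℝ] ℝ) x
      (form x))

variable {d M}

/-- The oriented plane spanned by a `2`-frame. -/
def orientedSpan (f : TwoFrames d M) : OrientedGrassmannian d M :=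
  Quotient.mk (orientedPlaneSetoid d M) f

/-- The bundle projection `Gr₂(TM) → M`. -/
def OrientedGrassmannian.proj : OrientedGrassmannian d M → M :=
  Quotient.lift (fun f ↦ f.1.1) fun f g (h : SameOrientedPlane d M f g) ↦ by
    obtain ⟨_, _, _, _, _, h⟩ := h
    rw [h]

/-- The symplectic `2`-planes: oriented planes `P` on which `β` is non-degenerate and whose
orientation is the one induced by `β|_P`; equivalently `β(a, b) > 0` for an oriented basis
`(a, b)` of `P`. -/
def SymplecticPlanes (β : NondegenerateTwoForm d M) : Set (OrientedGrassmannian d M) :=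
  orientedSpan '' {f : TwoFrames d M | 0 < β.form f.1.1 f.1.2.1 f.1.2.2}

/-- `Sp₂(M)`: paths in `Gr₂(TM)` that stay over one point of `M` and end in a symplectic plane,
with the compact-open topology. -/
abbrev SymplecticPathSpace (β : NondegenerateTwoForm d M) : Type u :=
  {γ : C(I, OrientedGrassmannian d M) //
    γ 1 ∈ SymplecticPlanes β ∧ ∀ s t : I, (γ s).proj = (γ t).proj}

/-- The map `ε : Sp₂(M) → Gr₂(TM)`, `γ ↦ γ 0`. -/
def startingPlane (β : NondegenerateTwoForm d M) :
    SymplecticPathSpace β → OrientedGrassmannian d M :=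
  fun γ ↦ γ.1 0

end Grassmannian

end

/-! ### Hurewicz uniformization: gluing local liftings of homotopies. -/

section Uniformization

/-! The fibration property is local over `M`. Near a point, a linear-algebra version of Moser's
trick (`exists_continuousOn_pullback_eq`) trivializes `TM` so that the form becomes constant; planes
can then be carried between nearby fibers without losing symplecticity. To lift a homotopy of
starting planes, prepend to each given vertical path the reversed track of the homotopy, everything
being carried into the current fiber (`hasLiftsOver_startingPlane`). Since `M` is metrizable, the
local liftings glue by `HasLiftsOver.of_local`.

A point of the fiber over `P` is a path of oriented planes in one tangent space, from `P` to a
symplectic plane. The map from frames to oriented planes also has the homotopy lifting property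
(`hasLiftsOver_linFrames`, by Plücker coordinates and the same gluing theorem), so all these paths
lift, continuously and simultaneously, to paths of frames starting at a fixed frame
(`exists_lift_to_frames`).

For paths of frames, connectivity is a matter of general position. An `i`-parameter family is
contracted linearly in pairs of vectors; the contraction has `i + 1` parameters at the end points of
the paths and `i + 2` altogether. Dependent pairs have codimension `d - 1`, so they can be avoided
when `i + 3 < d` (`exists_continuous_linearIndependent`). The end points can be kept positive
because a pair with non-zero first vector becomes positive after adding a multiple of a dual vector
to the second (`exists_continuous_form_pos`). With `d ≥ 6` this covers `i ≤ 2`. -/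

/-- `p` has the homotopy lifting property for homotopies with values in `A`. -/
def HasLiftsOver {X : Type u} {B : Type v} [TopologicalSpace X] [TopologicalSpace B]
    (p : X → B) (A : Set B) : Prop :=
  ∀ (Y : Type w) [TopologicalSpace Y] (H : C(Y × I, B)) (f : C(Y, X)),
    (∀ y, p (f y) = H (y, 0)) → (∀ z, H z ∈ A) →
      ∃ G : C(Y × I, X), (∀ y, G (y, 0) = f y) ∧ ∀ z, p (G z) = H z

/-- Every lift of `H` at time `θ` extends to a lift on the time interval from `θ` to `τ`. -/
def LiftsBetween {X : Type u} {B : Type v} {Y : Type w} [TopologicalSpace X] [TopologicalSpace B]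
    [TopologicalSpace Y] (p : X → B) (H : C(Y × I, B)) (θ τ : C(Y, I)) : Prop :=
  ∀ e : C(Y, X), (∀ y, p (e y) = H (y, θ y)) →
    ∃ K : C(Y × I, X), (∀ y, K (y, θ y) = e y) ∧
      ∀ y t, θ y ≤ t → t ≤ τ y → p (K (y, t)) = H (y, t)

variable {X : Type u} {B : Type v} {Y : Type w} [TopologicalSpace X] [TopologicalSpace B]
  [TopologicalSpace Y] {p : X → B} {H : C(Y × I, B)}

/-- Two maps on `Y × I` that agree along the graph of `τ` can be concatenated there. -/
theorem exists_concat_along {τ : C(Y, I)} (K L : C(Y × I, X))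
    (h : ∀ y, K (y, τ y) = L (y, τ y)) :
    ∃ G : C(Y × I, X), (∀ y t, t ≤ τ y → G (y, t) = K (y, t)) ∧
      ∀ y t, τ y ≤ t → G (y, t) = L (y, t) := by
  classical
  refine ⟨⟨fun z ↦ if z.2 ≤ τ z.1 then K z else L z, ?_⟩, ?_, ?_⟩
  · refine Continuous.if_le K.continuous L.continuous continuous_snd
      (τ.continuous.comp continuous_fst) ?_
    rintro ⟨y, t⟩ (rfl : t = τ y)
    exact h y
  · intro y t ht
    simp [ht]
  · intro y t ht
    rcases ht.eq_or_lt with rfl | ht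
    · simp [h]
    · simp [not_le.2 ht]

theorem LiftsBetween.refl (θ : C(Y, I)) : LiftsBetween p H θ θ := by
  intro e he
  refine ⟨e.comp ⟨Prod.fst, continuous_fst⟩, fun y ↦ rfl, fun y t h₁ h₂ ↦ ?_⟩
  obtain rfl := le_antisymm h₁ h₂
  exact he y

theorem LiftsBetween.trans {θ τ ρ : C(Y, I)} (hθτ : θ ≤ τ)
    (h₁ : LiftsBetween p H θ τ) (h₂ : LiftsBetween p H τ ρ) : LiftsBetween p H θ ρ := by
  intro e he
  obtain ⟨K, hK, hK'⟩ := h₁ e he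
  obtain ⟨L, hL, hL'⟩ := h₂ (K.comp ⟨fun y ↦ (y, τ y), by fun_prop⟩)
    (fun y ↦ hK' y _ (hθτ y) le_rfl)
  obtain ⟨G, hG, hG'⟩ := exists_concat_along K L (fun y ↦ (hL y).symm)
  refine ⟨G, fun y ↦ (hG y _ (hθτ y)).trans (hK y), fun y t h h' ↦ ?_⟩
  rcases le_total t (τ y) with ht | ht
  · rw [hG y t ht, hK' y t h ht]
  · rw [hG' y t ht, hL' y t ht h']

theorem LiftsBetween.of_monotone {θ : ℕ → C(Y, I)} (hθ : Monotone θ)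
    (n : ℕ) (h : ∀ k < n, LiftsBetween p H (θ k) (θ (k + 1))) : LiftsBetween p H (θ 0) (θ n) := by
  induction n with
  | zero => exact .refl _
  | succ n ih =>
    exact (ih fun k hk ↦ h k (hk.trans n.lt_succ_self)).trans (hθ (Nat.zero_le n))
      (h n n.lt_succ_self)

/-- If the homotopy moves only over a closed set `C`, and stays in `A` there, then it lifts. -/
theorem HasLiftsOver.liftsBetween {A : Set B} (hp : HasLiftsOver.{u, v, w} p A) (hA : IsOpen A)
    {θ τ : C(Y, I)} (hθτ : θ ≤ τ) {C : Set Y} (hC : IsClosed C)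
    (hout : ∀ y, y ∉ C → θ y = τ y)
    (hin : ∀ y ∈ C, ∀ t, θ y ≤ t → t ≤ τ y → H (y, t) ∈ A) :
    LiftsBetween p H θ τ := by
  classical
  intro e he
  -- Lifting is done over an open neighbourhood `O` of `C`. At points of `O` outside `C` only time
  -- `0` of the lift will be used, so the lift agrees there with `e` and extends by `e` to all of
  -- `Y`.
  set O : Set Y := {y | ∀ t, θ y ≤ t → t ≤ τ y → H (y, t) ∈ A} with hO
  have hOo : IsOpen O := by
    -- The complement of `O` is the projection of a closed set along the compact factor `I`.
    have hcl : IsClosed {z : Y × I | θ z.1 ≤ z.2 ∧ z.2 ≤ τ z.1 ∧ H z ∈ Aᶜ} := by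
      refine (isClosed_le (by fun_prop) (by fun_prop)).inter
        ((isClosed_le (by fun_prop) (by fun_prop)).inter ?_)
      exact hA.isClosed_compl.preimage H.continuous
    have := isClosedMap_fst_of_compactSpace _ hcl
    convert this.isOpen_compl using 1
    ext y
    simp [hO]
  have hCO : C ⊆ O := hin
  let clamp : ℝ → I := Set.projIcc 0 1 zero_le_one
  have hclamp : Continuous clamp := continuous_projIcc
  have hcl : ∀ t : I, clamp t = t := fun t ↦ Set.projIcc_val zero_le_one t
  -- `H` run from time `θ` at unit speed and stopped at `τ`; `K` below undoes this time shift.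
  let h : C(O × I, B) := ⟨fun z ↦ H (z.1, clamp (min (θ z.1 + z.2 : ℝ) (τ z.1))), by fun_prop⟩
  obtain ⟨G, hG, hG'⟩ := hp O h (e.comp ⟨Subtype.val, continuous_subtype_val⟩) (by
    intro y
    have : (min (θ y : ℝ) (τ y)) = θ y := min_eq_left (hθτ y)
    simp only [ContinuousMap.comp_apply, ContinuousMap.coe_mk, he, h, Set.Icc.coe_zero, add_zero,
      this, hcl]) (by
    rintro ⟨y, s⟩
    have h1 : (0 : ℝ) ≤ θ y := (θ y).2.1
    have h2 : (θ y : ℝ) ≤ τ y := hθτ y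
    have h3 : (τ y : ℝ) ≤ 1 := (τ y).2.2
    have h4 : (0 : ℝ) ≤ s := s.2.1
    have hmem : (min (θ y + s : ℝ) (τ y)) ∈ Set.Icc (0 : ℝ) 1 :=
      ⟨le_min (by linarith) (by linarith), (min_le_right _ _).trans h3⟩
    have hc : clamp (min (θ y + s : ℝ) (τ y)) = ⟨_, hmem⟩ := Set.projIcc_of_mem _ hmem
    change H (y, clamp _) ∈ A
    rw [hc]
    exact y.2 _ (Subtype.coe_le_coe.1 (le_min (by linarith) h2))
      (Subtype.coe_le_coe.1 (min_le_right _ _)))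
  let K : Y × I → X := fun z ↦ if hz : z.1 ∈ O then
    G (⟨z.1, hz⟩, clamp (min (z.2 : ℝ) (τ z.1) - θ z.1)) else e z.1
  have hzero : clamp 0 = 0 := hcl 0
  have hKe : ∀ y t, y ∉ C → K (y, t) = e y := by
    intro y t hy
    by_cases hyO : y ∈ O
    · have h : min (t : ℝ) (τ y) - θ y ≤ 0 := by
        have := min_le_right (t : ℝ) (τ y)
        rw [hout y hy]
        linarith
      have h' : clamp (min (t : ℝ) (τ y) - θ y) = 0 := Set.projIcc_of_le_left _ h
      simp only [K, hyO, dif_pos, h', hG]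
      rfl
    · simp [K, hyO]
  have hK : Continuous K := by
    refine continuous_iff_continuousAt.2 ?_
    rintro ⟨y, t⟩
    by_cases hyO : y ∈ O
    · have hemb : Topology.IsOpenEmbedding (Prod.map (Subtype.val : O → Y) (id : I → I)) :=
        hOo.isOpenEmbedding_subtypeVal.prodMap .id
      refine (hemb.continuousAt_iff (x := (⟨y, hyO⟩, t))).1 ?_
      have : K ∘ Prod.map (Subtype.val : O → Y) (id : I → I) =
          fun z ↦ G (z.1, clamp (min (z.2 : ℝ) (τ z.1) - θ z.1)) := by
        ext z
        simp [K]
      rw [this]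
      exact Continuous.continuousAt (by fun_prop)
    · have hyC : y ∉ C := fun h ↦ hyO (hCO h)
      have : K =ᶠ[𝓝 (y, t)] fun z ↦ e z.1 := by
        filter_upwards [(hC.isOpen_compl.preimage continuous_fst).mem_nhds
          (show (y, t) ∈ Prod.fst ⁻¹' Cᶜ from hyC)] with z hz
        exact hKe z.1 z.2 hz
      exact ContinuousAt.congr (by fun_prop) this.symm
  refine ⟨⟨K, hK⟩, fun y ↦ ?_, fun y t h₁ h₂ ↦ ?_⟩
  · by_cases hyO : y ∈ O
    · have : min (θ y : ℝ) (τ y) - θ y = 0 := by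
        rw [min_eq_left (show (θ y : ℝ) ≤ τ y from hθτ y), sub_self]
      simp only [ContinuousMap.coe_mk, K, hyO, dif_pos, this, hzero, hG]
      rfl
    · simp [K, hyO]
  · by_cases hyO : y ∈ O
    · have h₁' : (θ y : ℝ) ≤ t := h₁
      have h₂' : (t : ℝ) ≤ τ y := h₂
      have hmem : (min (t : ℝ) (τ y) - θ y) ∈ Set.Icc (0 : ℝ) 1 := by
        rw [min_eq_left h₂']
        exact ⟨by linarith, by linarith [t.2.2, (θ y).2.1]⟩
      have hc : clamp (min (t : ℝ) (τ y) - θ y) = ⟨_, hmem⟩ := Set.projIcc_of_mem _ hmem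
      simp only [ContinuousMap.coe_mk, K, hyO, dif_pos, hG', hc, h]
      rw [min_eq_left h₂', add_sub_cancel, min_eq_left h₂', hcl]
    · have hyC : y ∉ C := fun h ↦ hyO (hCO h)
      have hte : t = θ y := le_antisymm (hout y hyC ▸ h₂) h₁
      simp [K, hyO, he, hte]

/-- Lifts over a locally finite sequence of time steps assemble to a lift. -/
theorem exists_lift_of_liftsBetween {θ : ℕ → C(Y, I)} (hθ : Monotone θ) (h0 : ∀ y, θ 0 y = 0)
    (h1 : ∀ y, ∃ n, ∀ᶠ y' in 𝓝 y, θ n y' = 1)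
    (h : ∀ k, LiftsBetween p H (θ k) (θ (k + 1))) (f : C(Y, X)) (hf : ∀ y, p (f y) = H (y, 0)) :
    ∃ G : C(Y × I, X), (∀ y, G (y, 0) = f y) ∧ ∀ z, p (G z) = H z := by
  classical
  have step : ∀ k (K : C(Y × I, X)), (∀ y t, t ≤ θ k y → p (K (y, t)) = H (y, t)) →
      ∃ L : C(Y × I, X), (∀ y t, t ≤ θ (k + 1) y → p (L (y, t)) = H (y, t)) ∧
        ∀ y t, t ≤ θ k y → L (y, t) = K (y, t) := by
    intro k K hK
    obtain ⟨L, hL, hL'⟩ := h k (K.comp ⟨fun y ↦ (y, θ k y), by fun_prop⟩)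
      (fun y ↦ hK y _ le_rfl)
    obtain ⟨G, hG, hG'⟩ := exists_concat_along K L (fun y ↦ (hL y).symm)
    refine ⟨G, fun y t ht ↦ ?_, hG⟩
    rcases le_total t (θ k y) with ht' | ht'
    · rw [hG y t ht', hK y t ht']
    · rw [hG' y t ht', hL' y t ht' ht]
  choose! next hnext hnext' using step
  let K : ℕ → C(Y × I, X) := fun n ↦
    Nat.rec (f.comp ⟨Prod.fst, continuous_fst⟩) (fun k K ↦ next k K) n
  have hK : ∀ n, ∀ y t, t ≤ θ n y → p (K n (y, t)) = H (y, t) := by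
    intro n
    induction n with
    | zero =>
      intro y t ht
      rw [h0, le_zero_iff] at ht
      subst ht
      exact hf y
    | succ n ih => exact hnext n (K n) ih
  have hKle : ∀ m n, m ≤ n → ∀ y t, t ≤ θ m y → K n (y, t) = K m (y, t) := by
    intro m n hmn
    induction n, hmn using Nat.le_induction with
    | base => intros; rfl
    | succ n hmn ih =>
      intro y t ht
      rw [← ih y t ht]
      exact hnext' n (K n) (hK n) y t (ht.trans (hθ hmn y))
  have hev : ∀ y, ∃ n, θ n y = 1 := fun y ↦ (h1 y).imp fun n hn ↦ hn.self_of_nhds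
  -- At `y` the maps `K n` no longer change once `θ n y = 1`. By `h1` such an index can be chosen
  -- locally uniformly, so `G` is locally one of the `K n`.
  let G : Y × I → X := fun z ↦ K (Nat.find (hev z.1)) z
  have hGK : ∀ n z, θ n z.1 = 1 → G z = K n z := by
    rintro n ⟨y, t⟩ hn
    refine (hKle _ n (Nat.find_min' (hev y) hn) y t ?_).symm
    rw [Nat.find_spec (hev y)]
    exact t.2.2
  refine ⟨⟨G, continuous_iff_continuousAt.2 ?_⟩, fun y ↦ ?_, ?_⟩
  · rintro ⟨y, t⟩
    obtain ⟨n, hn⟩ := h1 y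
    refine (K n).continuous.continuousAt.congr ?_
    filter_upwards [continuous_fst.continuousAt.eventually hn] with z hz
    exact (hGK n z hz).symm
  · exact hKle 0 _ (Nat.zero_le _) y 0 (by rw [h0])
  · rintro ⟨y, t⟩
    exact hK _ y t (by rw [Nat.find_spec (hev y)]; exact t.2.2)


/-- The point `k / (m + 1)` of the unit interval (or `1`, if `k > m`). -/
noncomputable def gridPoint (m k : ℕ) : I := Set.projIcc 0 1 zero_le_one ((k : ℝ) / (m + 1))

theorem gridPoint_zero (m : ℕ) : gridPoint m 0 = 0 := by
  simp [gridPoint]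

theorem gridPoint_succ_self (m : ℕ) : gridPoint m (m + 1) = 1 := by
  have : (m : ℝ) + 1 ≠ 0 := by positivity
  simp [gridPoint, div_self this]

theorem monotone_gridPoint (m : ℕ) : Monotone (gridPoint m) := fun i j hij ↦ by
  refine Set.monotone_projIcc _ ?_
  gcongr

variable {N : Type*} [TopologicalSpace N]

/-- The paths in `N` whose restriction to the `k`-th piece of the grid of mesh `1 / (w.1 + 1)` lies
in `V (w.2 k)`. -/
def gridPaths (V : ℕ → Set N) (w : ℕ × List ℕ) : Set C(I, N) :=
  -- Short lists are padded by `0`. All that matters is that the patterns form a countable index set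
  -- and that every assignment of cover members to pieces occurs.
  {c | ∀ k ≤ w.1, Set.MapsTo c (Set.Icc (gridPoint w.1 k) (gridPoint w.1 (k + 1)))
    (V (w.2.getD k 0))}

theorem isOpen_gridPaths {V : ℕ → Set N} (hV : ∀ i, IsOpen (V i)) (w : ℕ × List ℕ) :
    IsOpen (gridPaths V w) := by
  have : gridPaths V w = ⋂ k ∈ Set.Iic w.1, {c : C(I, N) |
      Set.MapsTo c (Set.Icc (gridPoint w.1 k) (gridPoint w.1 (k + 1))) (V (w.2.getD k 0))} := by
    ext c
    simp [gridPaths]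
  rw [this]
  exact (Set.finite_Iic w.1).isOpen_biInter fun k _ ↦
    ContinuousMap.isOpen_setOfPred_mapsTo isCompact_Icc (hV _)

/-- The Lebesgue number lemma, applied to the cover of `I` pulled back along a path, supplies a fine
enough grid. -/
theorem iUnion_gridPaths {V : ℕ → Set N} (hV : ∀ i, IsOpen (V i)) (hcov : ⋃ i, V i = Set.univ) :
    ⋃ w, gridPaths V w = Set.univ := by
  refine Set.eq_univ_of_forall fun c ↦ ?_
  obtain ⟨δ, hδ, hc⟩ := lebesgue_number_lemma_of_metric (isCompact_univ (X := I))
    (fun i ↦ (hV i).preimage c.continuous) (by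
      rw [← Set.preimage_iUnion, hcov, Set.preimage_univ])
  obtain ⟨m, hm⟩ := exists_nat_one_div_lt hδ
  have hpiece : ∀ k ≤ m, ∃ i, Set.MapsTo c (Set.Icc (gridPoint m k) (gridPoint m (k + 1))) (V i) := by
    intro k hk
    obtain ⟨i, hi⟩ := hc (gridPoint m k) trivial
    refine ⟨i, fun t ht ↦ hi ?_⟩
    have hm0 : (0 : ℝ) < m + 1 := by positivity
    have hkm : (k : ℝ) + 1 ≤ m + 1 := by
      have : (k : ℝ) ≤ m := by exact_mod_cast hk
      linarith
    have e1 : ((gridPoint m k : I) : ℝ) = k / (m + 1) := by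
      rw [gridPoint, Set.projIcc_of_mem]
      exact ⟨by positivity, by rw [div_le_one hm0]; linarith⟩
    have e2 : ((gridPoint m (k + 1) : I) : ℝ) = k / (m + 1) + 1 / (m + 1) := by
      rw [gridPoint, Set.projIcc_of_mem]
      · push_cast
        rw [add_div]
      · push_cast
        exact ⟨by positivity, by rwa [div_le_one hm0]⟩
    have h1 : ((gridPoint m k : I) : ℝ) ≤ t := ht.1
    have h2 : (t : ℝ) ≤ (gridPoint m (k + 1) : I) := ht.2
    rw [Metric.mem_ball, Subtype.dist_eq, Real.dist_eq, abs_lt]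
    constructor <;> linarith
  choose! i hi using hpiece
  refine Set.mem_iUnion.2 ⟨(m, (List.range (m + 1)).map i), fun k hk ↦ ?_⟩
  have hk' : k < m + 1 := Nat.lt_succ_of_le hk
  convert hi k hk using 2
  simp [List.getD, hk']

/-- A homotopy that moves only over a closed set, along paths that lie over a single grid pattern
there, can be lifted if homotopies lift over all members of the cover. -/
theorem liftsBetween_of_gridPaths {V : ℕ → Set N} (hV : ∀ i, IsOpen (V i)) {ψ : C(B, N)}
    (hp : ∀ i, HasLiftsOver.{u, v, w} p (ψ ⁻¹' V i)) (w : ℕ × List ℕ) {γ : Y → C(I, N)}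
    (hγ : ∀ y t, γ y t = ψ (H (y, t))) {a b : C(Y, I)} (hab : a ≤ b) {C : Set Y} (hC : IsClosed C)
    (hout : ∀ y, y ∉ C → a y = b y) (hin : ∀ y ∈ C, γ y ∈ gridPaths V w) :
    LiftsBetween p H a b := by
  obtain ⟨m, l⟩ := w
  -- Grid points clamped to `[a, b]`, so that each step stays inside one piece of the grid.
  let θ : ℕ → C(Y, I) := fun k ↦ a ⊔ (b ⊓ ContinuousMap.const Y (gridPoint m k))
  have hθ : Monotone θ := fun i j hij y ↦
    sup_le_sup le_rfl (inf_le_inf le_rfl (monotone_gridPoint m hij))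
  have h0 : θ 0 = a := by
    ext y
    simp [θ, gridPoint_zero]
  have h1 : θ (m + 1) = b := by
    ext y
    have : a y ≤ b y := hab y
    have h2 : b y ≤ 1 := (b y).2.2
    simp [θ, gridPoint_succ_self, this, h2]
  rw [← h0, ← h1]
  refine LiftsBetween.of_monotone hθ (m + 1) fun k hk ↦ ?_
  refine (hp (l.getD k 0)).liftsBetween ((hV _).preimage ψ.continuous) (hθ (Nat.le_succ k))
    -- The points of `C` where the `k`-th grid piece meets `[a, b]`. Elsewhere the two clamped times
    -- coincide; here they lie in that piece, so `hin` applies.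
    (C := C ∩ {y | a y ≤ gridPoint m (k + 1) ∧ gridPoint m k ≤ b y}) ?_ ?_ ?_
  · exact hC.inter ((isClosed_le (by fun_prop) (by fun_prop)).inter
      (isClosed_le (by fun_prop) (by fun_prop)))
  · intro y hy
    have hmon : gridPoint m k ≤ gridPoint m (k + 1) := monotone_gridPoint m (Nat.le_succ k)
    simp only [ContinuousMap.sup_apply, ContinuousMap.inf_apply, ContinuousMap.const_apply, θ]
    by_cases hyC : y ∈ C
    · by_cases h : a y ≤ gridPoint m (k + 1)
      · have h' : b y < gridPoint m k := by
          by_contra h'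
          exact hy ⟨hyC, h, not_lt.1 h'⟩
        rw [inf_eq_left.2 h'.le, inf_eq_left.2 (h'.le.trans hmon)]
      · have h' := (not_le.1 h).le
        rw [sup_eq_left.2 (inf_le_right.trans (hmon.trans h')),
          sup_eq_left.2 (inf_le_right.trans h')]
    · rw [hout y hyC, sup_inf_self, sup_inf_self]
  · rintro y ⟨hyC, hya, hyb⟩ t h₁ h₂
    simp only [ContinuousMap.sup_apply, ContinuousMap.inf_apply, ContinuousMap.const_apply, θ]
      at h₁ h₂
    have := hin y hyC k (Nat.lt_succ_iff.1 hk) (x := t)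
      ⟨(le_inf hyb le_rfl).trans (le_sup_right.trans h₁), h₂.trans (sup_le hya inf_le_right)⟩
    rwa [hγ] at this

/-- **Hurewicz uniformization**: a map that has the homotopy lifting property locally over a
separable metrizable space has the homotopy lifting property. -/
theorem HasLiftsOver.of_local [TopologicalSpace.MetrizableSpace N] [SecondCountableTopology N]
    (ψ : C(B, N))
    (h : ∀ x : N, ∃ U : Set N, IsOpen U ∧ x ∈ U ∧ HasLiftsOver.{u, v, w} p (ψ ⁻¹' U)) :
    HasLiftsOver.{u, v, w} p Set.univ := by
  classical
  intro Y _ H f hf _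
  let _ : MetricSpace N := TopologicalSpace.metrizableSpaceMetric N
  rcases isEmpty_or_nonempty Y with hY | ⟨⟨y₀⟩⟩
  · exact ⟨⟨fun z ↦ isEmptyElim z.1, continuous_iff_continuousAt.2 fun z ↦ isEmptyElim z.1⟩,
      fun y ↦ isEmptyElim y, fun z ↦ isEmptyElim z.1⟩
  choose U hUo hxU hpU using h
  obtain ⟨s, hs, hsU⟩ := TopologicalSpace.countable_cover_nhds
    (fun x ↦ (hUo x).mem_nhds (hxU x))
  have hsne : s.Nonempty := by
    by_contra hne
    rw [Set.not_nonempty_iff_eq_empty] at hne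
    have : ψ (H (y₀, 0)) ∈ ⋃ x ∈ s, U x := hsU ▸ trivial
    simp [hne] at this
  obtain ⟨g, rfl⟩ := hs.exists_eq_range hsne
  let V : ℕ → Set N := fun n ↦ U (g n)
  have hV : ∀ i, IsOpen (V i) := fun i ↦ hUo _
  have hcov : ⋃ i, V i = Set.univ := by rwa [Set.biUnion_range] at hsU
  let e : ℕ ≃ ℕ × List ℕ := (Denumerable.eqv (ℕ × List ℕ)).symm
  -- The partition of unity lives on the metrizable path space `C(I, N)`, not on the arbitrary space
  -- `Y`. Its partial sums, evaluated at the track of `y`, are the times `θ n y`: in step `n` only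
  -- points whose track follows pattern `n` move.
  obtain ⟨ρ, hρ⟩ := PartitionOfUnity.exists_isSubordinate (isClosed_univ (X := C(I, N)))
    (fun n ↦ gridPaths V (e n)) (fun n ↦ isOpen_gridPaths hV _) (by
      rw [e.surjective.iUnion_comp (gridPaths V), iUnion_gridPaths hV hcov])
  have hle : ∀ n c, ∑ i ∈ Finset.range n, ρ i c ≤ 1 := by
    intro n c
    rw [← ρ.sum_finsupport (Set.mem_univ c), ← Finset.sum_filter_ne_zero (Finset.range n)]
    refine Finset.sum_le_sum_of_subset_of_nonneg ?_ fun i _ _ ↦ ρ.nonneg i c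
    intro i hi
    simpa using (Finset.mem_filter.1 hi).2
  let T : ℕ → C(C(I, N), I) := fun n ↦
    ⟨fun c ↦ ⟨∑ i ∈ Finset.range n, ρ i c, Finset.sum_nonneg fun i _ ↦ ρ.nonneg i c, hle n c⟩,
      by fun_prop⟩
  let γ : C(Y, C(I, N)) := (ψ.comp H).curry
  let θ : ℕ → C(Y, I) := fun n ↦ (T n).comp γ
  have hθ : Monotone θ := by
    intro m n hmn y
    refine Subtype.coe_le_coe.1 ?_
    exact Finset.sum_le_sum_of_subset_of_nonneg (Finset.range_mono hmn)
      fun i _ _ ↦ ρ.nonneg i _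
  refine exists_lift_of_liftsBetween hθ (fun y ↦ ?_) (fun y ↦ ?_) (fun n ↦ ?_) f hf
  · ext
    simp [θ, T]
  · obtain ⟨O, hO, hfin⟩ := ρ.locallyFinite (γ y)
    obtain ⟨n, hn⟩ := hfin.bddAbove
    refine ⟨n + 1, ?_⟩
    filter_upwards [γ.continuous.continuousAt.eventually hO] with y' hy'
    ext
    change ∑ i ∈ Finset.range (n + 1), ρ i (γ y') = 1
    rw [← ρ.sum_eq_one (Set.mem_univ (γ y')), finsum_eq_sum_of_support_subset]
    intro i hi
    simp only [Finset.coe_range, Set.mem_Iio]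
    exact Nat.lt_succ_of_le (hn ⟨γ y', hi, hy'⟩)
  · refine liftsBetween_of_gridPaths hV (ψ := ψ) (fun i ↦ hpU _) (e n) (γ := γ) (fun _ _ ↦ rfl)
      (hθ (Nat.le_succ n)) ((isClosed_tsupport (ρ n)).preimage γ.continuous) (fun y hy ↦ ?_)
      (fun y hy ↦ hρ n hy)
    have : ρ n (γ y) = 0 := image_eq_zero_of_notMem_tsupport hy
    ext
    simp [θ, T, Finset.sum_range_succ, this]

end Uniformization

/-! ### Normal form for alternating forms near a non-degenerate one. -/

section SymplecticNormalForm

variable {E : Type*} [NormedAddCommGroup E] [NormedSpace ℝ E]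

theorem alternating_swap {η : E →L[ℝ] E →L[ℝ] ℝ} (h : ∀ v, η v v = 0) (v w : E) :
    η v w = -η w v := by
  have := h (v + w)
  simp only [map_add, add_apply, h, zero_add, add_zero] at this
  linarith

/-- A non-degenerate bilinear form identifies a finite-dimensional space with its dual. -/
noncomputable def formEquiv [FiniteDimensional ℝ E] (η : E →L[ℝ] E →L[ℝ] ℝ)
    (h : ∀ v, (∀ w, η v w = 0) → v = 0) : E ≃L[ℝ] (E →L[ℝ] ℝ) :=
  (LinearMap.linearEquivOfInjective η.toLinearMap
    ((injective_iff_map_eq_zero η).2 fun v hv ↦ h v fun w ↦ by rw [hv]; rfl)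
    (by
      rw [← Subspace.dual_finrank_eq (K := ℝ) (V := E)]
      exact (LinearMap.toContinuousLinearMap (𝕜 := ℝ) (E := E) (F' := ℝ)).finrank_eq)
    ).toContinuousLinearEquiv

theorem apply_formEquiv_symm [FiniteDimensional ℝ E] (η : E →L[ℝ] E →L[ℝ] ℝ)
    (h : ∀ v, (∀ w, η v w = 0) → v = 0) (l : E →L[ℝ] ℝ) : η ((formEquiv η h).symm l) = l :=
  (formEquiv η h).apply_symm_apply l

/-- Alternating forms close to a non-degenerate alternating form `η₀` are pull-backs of `η₀` by
linear maps that depend continuously on the form. -/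
theorem exists_continuousOn_pullback_eq [FiniteDimensional ℝ E] (η₀ : E →L[ℝ] E →L[ℝ] ℝ)
    (h₀ : ∀ v, η₀ v v = 0) (hnd : ∀ v, (∀ w, η₀ v w = 0) → v = 0) :
    ∃ (O : Set (E →L[ℝ] E →L[ℝ] ℝ)) (S : (E →L[ℝ] E →L[ℝ] ℝ) → E →L[ℝ] E),
      IsOpen O ∧ η₀ ∈ O ∧ ContinuousOn S O ∧
        ∀ η ∈ O, (∀ v, η v v = 0) → ∀ v w, η₀ (S η v) (S η w) = η v w := by
  have : CompleteSpace E := FiniteDimensional.complete ℝ E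
  -- Write `η = η₀(A ·, ·)` with `A` near `1`, and let `S` be the square root of `A` near `1`, which
  -- exists because squaring has derivative `2` at `1`. If `S` is self-adjoint for `η₀`, then `η₀(S
  -- v, S w) = η₀(S² v, w) = η(v, w)`.
  let R := E →L[ℝ] E
  let f' : R ≃L[ℝ] R := ContinuousLinearEquiv.smulLeft (Units.mk0 (2 : ℝ) two_ne_zero)
  have hf : HasStrictFDerivAt (fun T : R ↦ T * T) (f' : R →L[ℝ] R) 1 := by
    refine HasStrictFDerivAt.congr_fderiv
      ((hasStrictFDerivAt_id (𝕜 := ℝ) (1 : R)).mul' (hasStrictFDerivAt_id (𝕜 := ℝ) (1 : R))) ?_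
    refine ContinuousLinearMap.ext fun T ↦ ?_
    change (1 : R) * T + T * (1 : R) = (2 : ℝ) • T
    rw [one_mul, mul_one, two_smul]
  let e := hf.toOpenPartialHomeomorph
  have he : ∀ T, e T = T * T := fun T ↦ rfl
  have h1s : (1 : R) ∈ e.source := hf.mem_toOpenPartialHomeomorph_source
  have h1t : (1 : R) ∈ e.target := by
    have := e.map_source h1s
    rwa [he, one_mul] at this
  have hsymm1 : e.symm 1 = 1 := by
    have := e.left_inv h1s
    rwa [he, one_mul] at this
  let b := formEquiv η₀ hnd
  have hb : ∀ l, η₀ (b.symm l) = l := apply_formEquiv_symm η₀ hnd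
  have hinj : ∀ {v w : E}, (∀ u, η₀ v u = η₀ w u) → v = w := by
    intro v w hvw
    rw [← sub_eq_zero]
    refine hnd _ fun u ↦ ?_
    simp [hvw]
  let A : (E →L[ℝ] E →L[ℝ] ℝ) → R := fun η ↦ (b.symm : (E →L[ℝ] ℝ) →L[ℝ] E) ∘L η
  have hA : ∀ η v w, η₀ (A η v) w = η v w := fun η v w ↦ by
    change η₀ (b.symm (η v)) w = _
    rw [hb]
  have hAc : Continuous A := by fun_prop
  have hA0 : A η₀ = 1 := by
    ext v
    exact hinj fun w ↦ hA η₀ v w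
  let adj : R → R := fun T ↦ (b.symm : (E →L[ℝ] ℝ) →L[ℝ] E) ∘L
    (((ContinuousLinearMap.compL ℝ E E ℝ).flip T) ∘L η₀)
  have hadj : ∀ T v w, η₀ (adj T v) w = η₀ v (T w) := fun T v w ↦ by
    change η₀ (b.symm _) w = _
    rw [hb]
    rfl
  have hadjc : Continuous adj := by fun_prop
  have hadj1 : adj 1 = 1 := by
    ext v
    exact hinj fun w ↦ hadj 1 v w
  have hcont : ContinuousOn (fun η ↦ e.symm (A η)) (A ⁻¹' e.target) :=
    e.continuousOn_symm.comp hAc.continuousOn fun _ h ↦ h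
  -- The second condition keeps the adjoint of `S` in the domain where squaring is injective; this
  -- is what forces `S` to be self-adjoint.
  refine ⟨A ⁻¹' e.target ∩ (fun η ↦ adj (e.symm (A η))) ⁻¹' e.source, fun η ↦ e.symm (A η),
    ?_, ?_, ?_, ?_⟩
  · exact (hadjc.comp_continuousOn hcont).isOpen_inter_preimage
      (e.open_target.preimage hAc) e.open_source
  · refine ⟨?_, ?_⟩
    · simpa [hA0] using h1t
    · simpa [hA0, hsymm1, hadj1] using h1s
  · exact hcont.mono Set.inter_subset_left
  · rintro η ⟨hη₁, hη₂⟩ hη v w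
    set S := e.symm (A η) with hS
    have hSS : S * S = A η := e.right_inv hη₁
    -- The signs from the two alternating forms cancel.
    have hadjA : adj (A η) = A η := by
      ext v
      refine hinj fun w ↦ ?_
      rw [hadj, hA, alternating_swap h₀, hA, ← alternating_swap hη]
    have hadjSS : adj S * adj S = A η := by
      rw [← hadjA, ← hSS]
      ext v
      refine hinj fun w ↦ ?_
      simp only [mul_apply_eq_comp, hadj]
    have hself : adj S = S := by
      refine e.injOn hη₂ (e.map_target hη₁) ?_
      rw [he, he, hadjSS, hSS]
    rw [← hadj, hself, ← mul_apply_eq_comp, hSS, hA]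

end SymplecticNormalForm

/-! ### Local trivializations of the tangent bundle adapted to the form. -/

section Manifold

variable {d : ℕ} {M : Type u} [TopologicalSpace M] [ChartedSpace (EuclideanSpace ℝ (Fin d)) M]
  [IsManifold (𝓡 d) ∞ M]

/-- Around every point there are local trivializations of the tangent bundle in which a given
non-degenerate two-form becomes constant. -/
theorem exists_trivialization_form_eq (β : NondegenerateTwoForm d M) (x₀ : M) :
    ∃ (U : Set M) (Φ : ∀ x : M, TangentSpace (𝓡 d) x ≃L[ℝ] EuclideanSpace ℝ (Fin d))
      (η : EuclideanSpace ℝ (Fin d) →L[ℝ] EuclideanSpace ℝ (Fin d) →L[ℝ] ℝ),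
      IsOpen U ∧ x₀ ∈ U ∧ (∀ x ∈ U, ∀ v w, η (Φ x v) (Φ x w) = β.form x v w) ∧
      ContinuousOn (fun p : TangentBundle (𝓡 d) M ↦ Φ p.1 p.2)
        (TotalSpace.proj ⁻¹' U) ∧
      ContinuousOn (fun z : M × EuclideanSpace ℝ (Fin d) ↦
        (⟨z.1, (Φ z.1).symm z.2⟩ : TangentBundle (𝓡 d) M)) (U ×ˢ Set.univ) := by
  classical
  let E := EuclideanSpace ℝ (Fin d)
  let e := trivializationAt E (TangentSpace (𝓡 d) : M → Type) x₀
  have hx₀ : x₀ ∈ e.baseSet := FiberBundle.mem_baseSet_trivializationAt' x₀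
  let form' : M → E →L[ℝ] E →L[ℝ] ℝ := fun x ↦
    ContinuousLinearMap.bilinearComp (E := E) (F := E) (β.form x) (e.symmL ℝ x) (e.symmL ℝ x)
  have hform' : ∀ x v w, form' x v w = β.form x (e.symmL ℝ x v) (e.symmL ℝ x w) :=
    fun x v w ↦ rfl
  have hsec : ∀ v : E, ContinuousOn (fun x ↦ (⟨x, e.symmL ℝ x v⟩ : TangentBundle (𝓡 d) M))
      e.baseSet := by
    intro v
    have := e.continuousOn_symm.comp (f := fun x ↦ (x, v)) (s := e.baseSet) (by fun_prop)
      fun x hx ↦ ⟨hx, trivial⟩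
    refine this.congr fun x hx ↦ ?_
    simp only [Function.comp_apply]
    rw [e.symmL_apply hx]
  have hcont : ContinuousOn form' e.baseSet := by
    refine continuousOn_clm_apply.2 fun v ↦ continuousOn_clm_apply.2 fun w ↦ ?_
    have h := ContinuousOn.clm_bundle_apply₂ (F₃ := ℝ) (E₃ := Bundle.Trivial M ℝ) (b := id)
      (ψ := β.form) β.smooth.continuous.continuousOn (hsec v) (hsec w)
    exact (Bundle.Trivial.homeomorphProd M ℝ).continuous.snd.comp_continuousOn h
  have halt : ∀ x v, form' x v v = 0 := fun x v ↦ β.alternating x _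
  have hnd : ∀ x ∈ e.baseSet, ∀ v, (∀ w, form' x v w = 0) → v = 0 := by
    intro x hx v hv
    have h0 : e.symmL ℝ x v = 0 := by
      refine β.nondegenerate x _ fun b ↦ ?_
      have := hv (e.continuousLinearMapAt ℝ x b)
      rwa [hform', e.symmL_continuousLinearMapAt hx] at this
    rw [← e.continuousLinearMapAt_symmL (R := ℝ) hx v, h0, map_zero]
  obtain ⟨O, S, hO, hO₀, hS, hSη⟩ :=
    exists_continuousOn_pullback_eq (form' x₀) (halt x₀) (hnd x₀ hx₀)
  let U : Set M := e.baseSet ∩ form' ⁻¹' O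
  have hU : IsOpen U := hcont.isOpen_inter_preimage e.open_baseSet hO
  -- `S (form' x)` pulls a form back to a non-degenerate one, so its kernel is zero.
  have hinj : ∀ x ∈ U, Function.Injective (S (form' x)).toLinearMap := by
    intro x hx
    refine (injective_iff_map_eq_zero _).2 fun v hv ↦ hnd x hx.1 v fun w ↦ ?_
    rw [← hSη _ hx.2 (halt x)]
    rw [show S (form' x) v = 0 from hv]
    simp
  let Ψ : ∀ x, x ∈ U → E ≃L[ℝ] E := fun x hx ↦
    (LinearEquiv.ofInjectiveEndo (S (form' x)).toLinearMap (hinj x hx)).toContinuousLinearEquiv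
  have hΨ : ∀ x hx, (Ψ x hx : E →L[ℝ] E) = S (form' x) := fun x hx ↦ rfl
  let Φ : ∀ x : M, TangentSpace (𝓡 d) x ≃L[ℝ] E := fun x ↦
    if hx : x ∈ U then (e.continuousLinearEquivAt ℝ x hx.1).trans (Ψ x hx) else
      ContinuousLinearEquiv.refl ℝ E
  have hΦeq : ∀ x (hx : x ∈ U), Φ x = (e.continuousLinearEquivAt ℝ x hx.1).trans (Ψ x hx) :=
    fun x hx ↦ dif_pos hx
  have hΦ : ∀ x (hx : x ∈ U) v, Φ x v = S (form' x) (e ⟨x, v⟩).2 := by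
    intro x hx v
    rw [hΦeq x hx]
    rfl
  have hΦsymm : ∀ x (hx : x ∈ U) v,
      (Φ x).symm v = e.symm x ((S (form' x)).inverse v) := by
    intro x hx v
    rw [← hΨ x hx, ContinuousLinearMap.inverse_equiv]
    rw [hΦeq x hx]
    rfl
  have hSU : ContinuousOn (fun x ↦ S (form' x)) U :=
    hS.comp (hcont.mono Set.inter_subset_left) fun x hx ↦ hx.2
  refine ⟨U, Φ, form' x₀, hU, ⟨hx₀, hO₀⟩, fun x hx v w ↦ ?_, ?_, ?_⟩
  · rw [hΦ x hx, hΦ x hx, hSη _ hx.2 (halt x), hform']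
    have h : ∀ v : TangentSpace (𝓡 d) x, e.symmL ℝ x (e ⟨x, v⟩).2 = v := fun v ↦ by
      rw [← e.continuousLinearMapAt_apply_of_mem (R := ℝ) hx.1,
        e.symmL_continuousLinearMapAt hx.1]
    rw [h, h]
  · have h1 : ContinuousOn (fun p : TangentBundle (𝓡 d) M ↦ S (form' p.1) (e p).2)
        (TotalSpace.proj ⁻¹' U) := by
      refine ContinuousOn.clm_apply ?_ ?_
      · exact hSU.comp (FiberBundle.continuous_proj E _).continuousOn fun p hp ↦ hp
      · refine continuous_snd.comp_continuousOn (e.continuousOn.mono fun p hp ↦ ?_)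
        rw [e.mem_source]
        exact hp.1
    exact h1.congr fun p hp ↦ hΦ p.1 hp p.2
  · have hinv : ContinuousOn (fun x ↦ (S (form' x)).inverse) U := by
      intro x hx
      have h := (contDiffAt_map_inverse (n := 0) (Ψ x hx)).continuousAt
      rw [hΨ x hx] at h
      exact ContinuousAt.comp_continuousWithinAt (f := fun x ↦ S (form' x)) h (hSU x hx)
    have h1 : ContinuousOn (fun z : M × E ↦ (z.1, (S (form' z.1)).inverse z.2))
        (U ×ˢ Set.univ) :=
      continuousOn_fst.prodMk
        ((hinv.comp continuousOn_fst fun z hz ↦ hz.1).clm_apply continuousOn_snd)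
    refine (e.continuousOn_symm.comp h1 fun z hz ↦ ⟨hz.1.1, trivial⟩).congr fun z hz ↦ ?_
    simp only [Function.comp_apply]
    rw [hΦsymm z.1 hz.1]

end Manifold

/-! ### Topology of the Grassmannian bundle, transport of planes, and the fibration property. -/

noncomputable section Frames

theorem linearIndependent_pair_change {V : Type*} [AddCommGroup V] [Module ℝ V] {v w : V}
    (h : LinearIndependent ℝ ![v, w]) {a b c e : ℝ} (hD : 0 < a * e - b * c) :
    LinearIndependent ℝ ![a • v + b • w, c • v + e • w] := by
  rw [LinearIndependent.pair_iff] at h ⊢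
  intro s t hst
  obtain ⟨h1, h2⟩ := h (s * a + t * c) (s * b + t * e) (by rw [← hst]; module)
  constructor
  · have : s * (a * e - b * c) = 0 := by linear_combination e * h1 - c * h2
    exact (mul_eq_zero.1 this).resolve_right hD.ne'
  · have : t * (a * e - b * c) = 0 := by linear_combination a * h2 - b * h1
    exact (mul_eq_zero.1 this).resolve_right hD.ne'

theorem linearIndependent_pair_map {V W : Type*} [AddCommGroup V] [Module ℝ V] [AddCommGroup W]
    [Module ℝ W] {v w : V} (h : LinearIndependent ℝ ![v, w]) {T : V → W}
    (hT : ∀ s t : ℝ, s • T v + t • T w = 0 → s • v + t • w = 0) :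
    LinearIndependent ℝ ![T v, T w] := by
  rw [LinearIndependent.pair_iff] at h ⊢
  exact fun s t hst ↦ h s t (hT s t hst)

variable {d : ℕ} {M : Type u} [TopologicalSpace M] [ChartedSpace (EuclideanSpace ℝ (Fin d)) M]
  [IsManifold (𝓡 d) ∞ M]

/-- Continuity is tested in a trivialization around the image point, which is linear on fibers. -/
theorem continuousOn_linear_comb {Z : Type*} [TopologicalSpace Z] {s : Set Z} {x : Z → M}
    {v w : ∀ z, TangentSpace (𝓡 d) (x z)}
    (hv : ContinuousOn (fun z ↦ (⟨x z, v z⟩ : TangentBundle (𝓡 d) M)) s)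
    (hw : ContinuousOn (fun z ↦ (⟨x z, w z⟩ : TangentBundle (𝓡 d) M)) s) (a b : ℝ) :
    ContinuousOn (fun z ↦ (⟨x z, a • v z + b • w z⟩ : TangentBundle (𝓡 d) M)) s := by
  intro z₀ hz₀
  have hv' := (FiberBundle.continuousWithinAt_totalSpace (EuclideanSpace ℝ (Fin d)) _).1 (hv z₀ hz₀)
  have hw' := (FiberBundle.continuousWithinAt_totalSpace (EuclideanSpace ℝ (Fin d)) _).1 (hw z₀ hz₀)
  refine (FiberBundle.continuousWithinAt_totalSpace (EuclideanSpace ℝ (Fin d)) _).2 ⟨hv'.1, ?_⟩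
  have hx : ContinuousWithinAt x s z₀ := hv'.1
  let e := trivializationAt (EuclideanSpace ℝ (Fin d)) (TangentSpace (𝓡 d) : M → Type) (x z₀)
  have hmem : ∀ᶠ z in 𝓝[s] z₀, x z ∈ e.baseSet :=
    hx (e.open_baseSet.mem_nhds (FiberBundle.mem_baseSet_trivializationAt' _))
  have hlin : ∀ z, x z ∈ e.baseSet → (e ⟨x z, a • v z + b • w z⟩).2 =
      a • (e ⟨x z, v z⟩).2 + b • (e ⟨x z, w z⟩).2 := by
    intro z hz
    have h := e.linear ℝ hz
    rw [h.map_add, h.map_smul, h.map_smul]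
  refine ((hv'.2.const_smul a).add (hw'.2.const_smul b)).congr_of_eventuallyEq ?_
    (hlin z₀ (FiberBundle.mem_baseSet_trivializationAt' _))
  filter_upwards [hmem] with z hz using hlin z hz

/-- The Whitney sum carries the topology induced from `TM × TM`. -/
theorem continuousOn_frames_iff {Z : Type*} [TopologicalSpace Z] {s : Set Z}
    {f : Z → TwoFrames d M} :
    ContinuousOn f s ↔
      ContinuousOn (fun z ↦ (⟨(f z).1.1, (f z).1.2.1⟩ : TangentBundle (𝓡 d) M)) s ∧
      ContinuousOn (fun z ↦ (⟨(f z).1.1, (f z).1.2.2⟩ : TangentBundle (𝓡 d) M)) s := by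
  have hpair : ∀ {A B : Type u} [TopologicalSpace A] [TopologicalSpace B] {a : Z → A} {b : Z → B},
      ContinuousOn a s ∧ ContinuousOn b s ↔ ContinuousOn (fun z ↦ (a z, b z)) s :=
    ⟨fun h ↦ h.1.prodMk h.2, fun h ↦ ⟨h.fst, h.snd⟩⟩
  rw [hpair]
  exact Topology.IsInducing.subtypeVal.continuousOn_iff.trans
    (FiberBundle.Prod.isInducing_diag (EuclideanSpace ℝ (Fin d)) (TangentSpace (𝓡 d) : M → Type)
      (EuclideanSpace ℝ (Fin d)) (TangentSpace (𝓡 d) : M → Type)).continuousOn_iff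

/-- Multiplication of a frame by a matrix with positive determinant. -/
def frameChange (a b c e : ℝ) (hD : 0 < a * e - b * c) (f : TwoFrames d M) : TwoFrames d M :=
  ⟨⟨f.1.1, (a • f.1.2.1 + b • f.1.2.2, c • f.1.2.1 + e • f.1.2.2)⟩,
    linearIndependent_pair_change f.2 hD⟩

theorem continuous_frameChange (a b c e : ℝ) (hD : 0 < a * e - b * c) :
    Continuous (frameChange a b c e hD : TwoFrames d M → TwoFrames d M) := by
  rw [← continuousOn_univ, continuousOn_frames_iff]
  obtain ⟨h1, h2⟩ := continuousOn_frames_iff.1 (continuousOn_id (α := TwoFrames d M) (s := Set.univ))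
  exact ⟨continuousOn_linear_comb h1 h2 a b, continuousOn_linear_comb h1 h2 c e⟩

/-- The saturation of an open set is the union of its preimages under the continuous action of
matrices of positive determinant. Openness matters later: it survives products with `M` and
restriction to fibers. -/
theorem isOpenQuotientMap_orientedSpan :
    IsOpenQuotientMap (orientedSpan : TwoFrames d M → OrientedGrassmannian d M) := by
  have hq : Topology.IsQuotientMap (orientedSpan : TwoFrames d M → OrientedGrassmannian d M) :=
    isQuotientMap_quotient_mk'
  refine .of_isOpenMap_isQuotientMap (fun O hO ↦ ?_) hq
  rw [← hq.isOpen_preimage]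
  have : orientedSpan ⁻¹' (orientedSpan '' O) =
      ⋃ (A : {A : ℝ × ℝ × ℝ × ℝ // 0 < A.1 * A.2.2.2 - A.2.1 * A.2.2.1}),
        (frameChange (M := M) (d := d) A.1.1 A.1.2.1 A.1.2.2.1 A.1.2.2.2 A.2) ⁻¹' O := by
    ext f
    simp only [Set.mem_preimage, Set.mem_image, Set.mem_iUnion]
    constructor
    · rintro ⟨g, hg, hgf⟩
      obtain ⟨a, b, c, e, hD, h⟩ : SameOrientedPlane d M f g := Quotient.exact hgf.symm
      refine ⟨⟨(a, b, c, e), hD⟩, ?_⟩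
      convert hg
      exact Subtype.ext h.symm
    · rintro ⟨⟨⟨a, b, c, e⟩, hD⟩, h⟩
      exact ⟨_, h, (Quotient.sound (⟨a, b, c, e, hD, rfl⟩ : SameOrientedPlane d M f _)).symm⟩
  rw [this]
  exact isOpen_iUnion fun A ↦ hO.preimage (continuous_frameChange _ _ _ _ A.2)

theorem continuous_orientedGrassmannian_proj :
    Continuous (OrientedGrassmannian.proj : OrientedGrassmannian d M → M) := by
  rw [← isOpenQuotientMap_orientedSpan.continuous_comp_iff]
  exact (FiberBundle.continuous_proj _ _).comp continuous_subtype_val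

/-- Transport of frames by means of a family of isomorphisms of the tangent spaces with a fixed
vector space. -/
def frameTransport (Φ : ∀ x : M, TangentSpace (𝓡 d) x ≃L[ℝ] EuclideanSpace ℝ (Fin d))
    (f : TwoFrames d M) (y : M) : TwoFrames d M :=
  ⟨⟨y, ((Φ y).symm (Φ f.1.1 f.1.2.1), (Φ y).symm (Φ f.1.1 f.1.2.2))⟩, by
    refine linearIndependent_pair_map (T := fun v ↦ (Φ y).symm (Φ f.1.1 v)) f.2 fun s t h ↦ ?_
    simpa only [← map_smul, ← map_add, EmbeddingLike.map_eq_zero_iff] using h⟩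

/-- Transport of oriented planes by means of a family of isomorphisms of the tangent spaces with a
fixed vector space. -/
def planeTransport (Φ : ∀ x : M, TangentSpace (𝓡 d) x ≃L[ℝ] EuclideanSpace ℝ (Fin d))
    (z : OrientedGrassmannian d M × M) : OrientedGrassmannian d M :=
  Quotient.lift (fun f ↦ orientedSpan (frameTransport Φ f z.2))
    (by
      rintro ⟨⟨x, v, w⟩, hf⟩ ⟨⟨y, v', w'⟩, hg⟩ ⟨a, b, c, e, hD, h⟩
      obtain ⟨rfl, h⟩ := TotalSpace.mk.inj h
      have h := eq_of_heq h
      simp only [Prod.mk.injEq] at h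
      obtain ⟨rfl, rfl⟩ := h
      refine Quotient.sound (⟨a, b, c, e, hD, ?_⟩ : SameOrientedPlane d M _ _)
      refine congrArg (TotalSpace.mk z.2) (Prod.ext ?_ ?_) <;>
        · simp only [map_add, map_smul]
          rfl) z.1

variable (Φ : ∀ x : M, TangentSpace (𝓡 d) x ≃L[ℝ] EuclideanSpace ℝ (Fin d))

theorem proj_planeTransport (P : OrientedGrassmannian d M) (y : M) :
    (planeTransport Φ (P, y)).proj = y := by
  obtain ⟨f, rfl⟩ := isOpenQuotientMap_orientedSpan.surjective P
  rfl

theorem planeTransport_proj (P : OrientedGrassmannian d M) : planeTransport Φ (P, P.proj) = P := by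
  obtain ⟨f, rfl⟩ := isOpenQuotientMap_orientedSpan.surjective P
  change orientedSpan (frameTransport Φ f f.1.1) = _
  congr 1
  refine Subtype.ext ?_
  change TotalSpace.mk f.1.1
    ((Φ f.1.1).symm (Φ f.1.1 f.1.2.1), (Φ f.1.1).symm (Φ f.1.1 f.1.2.2)) = f.1
  simp only [ContinuousLinearEquiv.symm_apply_apply]

variable {Φ} {U : Set M}

/-- On `U` both fibers see the same constant form `η`, so transport preserves the value of the form
on a frame. -/
theorem planeTransport_mem_symplecticPlanes {β : NondegenerateTwoForm d M}
    {η : EuclideanSpace ℝ (Fin d) →L[ℝ] EuclideanSpace ℝ (Fin d) →L[ℝ] ℝ}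
    (hη : ∀ x ∈ U, ∀ v w, η (Φ x v) (Φ x w) = β.form x v w) {P : OrientedGrassmannian d M}
    (hP : P ∈ SymplecticPlanes β) (hPU : P.proj ∈ U) {y : M} (hy : y ∈ U) :
    planeTransport Φ (P, y) ∈ SymplecticPlanes β := by
  obtain ⟨f, hf, rfl⟩ := hP
  refine ⟨frameTransport Φ f y, ?_, rfl⟩
  change 0 < β.form y ((Φ y).symm (Φ f.1.1 f.1.2.1)) ((Φ y).symm (Φ f.1.1 f.1.2.2))
  rw [← hη y hy, ContinuousLinearEquiv.apply_symm_apply, ContinuousLinearEquiv.apply_symm_apply,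
    hη f.1.1 hPU]
  exact hf

theorem continuousOn_planeTransport (hU : IsOpen U)
    (h1 : ContinuousOn (fun p : TangentBundle (𝓡 d) M ↦ Φ p.1 p.2) (TotalSpace.proj ⁻¹' U))
    (h2 : ContinuousOn (fun z : M × EuclideanSpace ℝ (Fin d) ↦
        (⟨z.1, (Φ z.1).symm z.2⟩ : TangentBundle (𝓡 d) M)) (U ×ˢ Set.univ)) :
    ContinuousOn (planeTransport Φ) {z | z.1.proj ∈ U ∧ z.2 ∈ U} := by
  have hframe : ContinuousOn (fun z : TwoFrames d M × M ↦ frameTransport Φ z.1 z.2)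
      {z | z.1.1.1 ∈ U ∧ z.2 ∈ U} := by
    obtain ⟨k1, k2⟩ := continuousOn_frames_iff.1
      (continuousOn_id (α := TwoFrames d M) (s := Set.univ))
    rw [continuousOn_univ] at k1 k2
    rw [continuousOn_frames_iff]
    constructor
    · refine h2.comp (t := U ×ˢ Set.univ) (f := fun z : TwoFrames d M × M ↦
        (z.2, Φ z.1.1.1 z.1.1.2.1)) (continuousOn_snd.prodMk ?_) fun z hz ↦ ⟨hz.2, trivial⟩
      exact h1.comp (s := {z : TwoFrames d M × M | z.1.1.1 ∈ U ∧ z.2 ∈ U})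
        (k1.comp continuous_fst).continuousOn fun z hz ↦ hz.1
    · refine h2.comp (t := U ×ˢ Set.univ) (f := fun z : TwoFrames d M × M ↦
        (z.2, Φ z.1.1.1 z.1.1.2.2)) (continuousOn_snd.prodMk ?_) fun z hz ↦ ⟨hz.2, trivial⟩
      exact h1.comp (s := {z : TwoFrames d M × M | z.1.1.1 ∈ U ∧ z.2 ∈ U})
        (k2.comp continuous_fst).continuousOn fun z hz ↦ hz.1
  -- Continuity descends from frames because the product of open quotient maps is again one.
  have hq := (isOpenQuotientMap_orientedSpan (d := d) (M := M)).prodMap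
    (IsOpenQuotientMap.id (X := M))
  rintro ⟨P, y⟩ ⟨hP, hy⟩
  obtain ⟨f, rfl⟩ := isOpenQuotientMap_orientedSpan.surjective P
  refine ContinuousAt.continuousWithinAt ?_
  refine (hq.continuousAt_comp_iff (x := (f, y))).1 ?_
  have hopen : IsOpen {z : TwoFrames d M × M | z.1.1.1 ∈ U ∧ z.2 ∈ U} :=
    (hU.preimage ((FiberBundle.continuous_proj _ _).comp
      (continuous_subtype_val.comp continuous_fst))).inter (hU.preimage continuous_snd)
  exact isOpenQuotientMap_orientedSpan.continuous.continuousAt.comp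
    (hframe.continuousAt (hopen.mem_nhds ⟨hP, hy⟩))

/-- Homotopies in the Grassmannian lift to vertical paths ending in symplectic planes, locally over
the manifold. -/
theorem hasLiftsOver_startingPlane (β : NondegenerateTwoForm d M) (hU : IsOpen U)
    {η : EuclideanSpace ℝ (Fin d) →L[ℝ] EuclideanSpace ℝ (Fin d) →L[ℝ] ℝ}
    (hη : ∀ x ∈ U, ∀ v w, η (Φ x v) (Φ x w) = β.form x v w)
    (h1 : ContinuousOn (fun p : TangentBundle (𝓡 d) M ↦ Φ p.1 p.2) (TotalSpace.proj ⁻¹' U))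
    (h2 : ContinuousOn (fun z : M × EuclideanSpace ℝ (Fin d) ↦
        (⟨z.1, (Φ z.1).symm z.2⟩ : TangentBundle (𝓡 d) M)) (U ×ˢ Set.univ)) :
    HasLiftsOver.{u, u, w} (startingPlane β) (OrientedGrassmannian.proj ⁻¹' U) := by
  classical
  intro Y _ H f hf hHU
  have hT := continuousOn_planeTransport hU h1 h2
  have hproj := continuous_orientedGrassmannian_proj (d := d) (M := M)
  let clamp : ℝ → I := Set.projIcc 0 1 zero_le_one
  have hclamp : Continuous clamp := continuous_projIcc
  have hcl : ∀ t : I, clamp t = t := fun t ↦ Set.projIcc_val zero_le_one t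
  have hf0 : ∀ y, (f y).1 0 = H (y, 0) := hf
  have hfproj : ∀ y s, ((f y).1 s).proj = (H (y, 0)).proj := fun y s ↦ by
    rw [← hf0]
    exact (f y).2.2 s 0
  have hfc : Continuous fun z : Y × I ↦ (f z.1).1 z.2 := by fun_prop
  -- The new path at `(y, t)` has length `1 + t` before rescaling by `s ↦ s (1 + t)`: `L` runs back
  -- along `H` from time `t` to `0`, then `R` follows the old path `f y`. Both are transported to
  -- the tangent space under `H (y, t)`, and they meet at the transport of `H (y, 0)`.
  let L : (Y × I) × I → OrientedGrassmannian d M := fun z ↦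
    planeTransport Φ (H (z.1.1, clamp (z.1.2 - z.2 * (1 + z.1.2))), (H z.1).proj)
  let R : (Y × I) × I → OrientedGrassmannian d M := fun z ↦
    planeTransport Φ ((f z.1.1).1 (clamp (z.2 * (1 + z.1.2) - z.1.2)), (H z.1).proj)
  have hL : Continuous L := hT.comp_continuous (by fun_prop) fun z ↦ ⟨hHU _, hHU _⟩
  have hR : Continuous R := by
    refine hT.comp_continuous (Continuous.prodMk (hfc.comp (f := fun z : (Y × I) × I ↦
      (z.1.1, clamp (z.2 * (1 + z.1.2) - z.1.2))) (by fun_prop)) (by fun_prop)) ?_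
    intro z
    refine ⟨?_, hHU _⟩
    change ((f z.1.1).1 _).proj ∈ U
    rw [hfproj]
    exact hHU _
  let F : (Y × I) × I → OrientedGrassmannian d M := fun z ↦
    if (z.2 * (1 + z.1.2) : ℝ) ≤ z.1.2 then L z else R z
  have hF : Continuous F := by
    refine Continuous.if_le hL hR (by fun_prop) (by fun_prop) fun z hz ↦ ?_
    have hc0 : clamp 0 = 0 := hcl 0
    simp only [L, R, hz, sub_self, hc0, hf0]
  have hFproj : ∀ z s, (F (z, s)).proj = (H z).proj := by
    intro z s
    simp only [F, L, R]
    split_ifs <;> exact proj_planeTransport _ _ _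
  have hF0 : ∀ z, F (z, 0) = H z := by
    rintro ⟨y, t⟩
    have ht : ((0 : I) * (1 + t) : ℝ) ≤ t := by simpa using t.2.1
    simp only [F, ht, if_true, L]
    rw [Set.Icc.coe_zero, zero_mul, sub_zero, hcl, planeTransport_proj]
  have hF1 : ∀ z, F (z, 1) ∈ SymplecticPlanes β := by
    rintro ⟨y, t⟩
    have ht : ¬ ((1 : I) * (1 + t) : ℝ) ≤ t := by
      simp
    have hc1 : clamp ((1 : I) * (1 + t) - t : ℝ) = 1 := by
      rw [Set.Icc.coe_one, one_mul, add_sub_cancel_right]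
      exact hcl 1
    simp only [F, ht, if_false, R, hc1]
    refine planeTransport_mem_symplecticPlanes hη (f y).2.1 ?_ (hHU _)
    rw [hfproj]
    exact hHU _
  have hFf : ∀ y s, F ((y, 0), s) = (f y).1 s := by
    intro y s
    by_cases hs : (s * (1 + (0 : I)) : ℝ) ≤ (0 : I)
    · have hs0 : s = 0 := by
        refine le_antisymm ?_ s.2.1
        have : (s : ℝ) ≤ 0 := by simpa using hs
        exact this
      rw [hs0, hF0, hf0]
    · simp only [F, hs, if_false, R]
      rw [Set.Icc.coe_zero, add_zero, mul_one, sub_zero, hcl, ← hfproj y s, planeTransport_proj]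
  refine ⟨⟨fun z ↦ ⟨⟨fun s ↦ F (z, s), by fun_prop⟩, hF1 z, fun s t ↦ ?_⟩, ?_⟩, fun y ↦ ?_, hF0⟩
  · exact (hFproj z s).trans (hFproj z t).symm
  · refine Continuous.subtype_mk ?_ _
    exact (ContinuousMap.curry ⟨F, hF⟩).continuous
  · exact Subtype.ext (ContinuousMap.ext fun s ↦ hFf y s)

/-- The evaluation map from the space of vertical paths ending in symplectic planes is a Hurewicz
fibration. -/
theorem isHurewiczFibration_startingPlane [T2Space M] [SecondCountableTopology M]
    (β : NondegenerateTwoForm d M) : IsHurewiczFibration.{u, u, w} (startingPlane β) := by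
  have : LocallyCompactSpace M := ChartedSpace.locallyCompactSpace (EuclideanSpace ℝ (Fin d)) M
  have : TopologicalSpace.MetrizableSpace M := TopologicalSpace.metrizableSpace_of_t3_secondCountable M
  refine ⟨?_, fun Y _ H f hf ↦ ?_⟩
  · change Continuous fun γ : SymplecticPathSpace β ↦ γ.1 0
    fun_prop
  · refine HasLiftsOver.of_local (p := startingPlane β)
      ⟨OrientedGrassmannian.proj, continuous_orientedGrassmannian_proj⟩ (fun x ↦ ?_) Y H f hf
      fun _ ↦ trivial
    obtain ⟨U, Φ, η, hU, hx, hη, h1, h2⟩ := exists_trivialization_form_eq β x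
    exact ⟨U, hU, hx, hasLiftsOver_startingPlane β hU hη h1 h2⟩

end Frames

/-! ### Lifting homotopies of planes in a fixed vector space to frames. -/

noncomputable section LinearFrames

/-- Pairs of linearly independent vectors in `ℝ^d`. -/
abbrev LinFrames (d : ℕ) : Type :=
  {f : EuclideanSpace ℝ (Fin d) × EuclideanSpace ℝ (Fin d) // LinearIndependent ℝ ![f.1, f.2]}

variable {d : ℕ}

theorem LinFrames.continuous_of_val {Z : Type*} [TopologicalSpace Z] {G : Z → LinFrames d}
    (h : Continuous fun z ↦ (G z).1) : Continuous G :=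
  h.subtype_mk _

/-- The Plücker coordinates of a frame. -/
def pluecker (f : LinFrames d) : Fin d → Fin d → ℝ :=
  fun i j ↦ f.1.1 i * f.1.2 j - f.1.1 j * f.1.2 i

theorem continuous_pluecker : Continuous (pluecker : LinFrames d → _) := by
  unfold pluecker
  fun_prop

/-- By antisymmetry, if no coordinate is positive then all vanish, and the two vectors are
proportional. -/
theorem exists_pluecker_pos (f : LinFrames d) : ∃ i j, 0 < pluecker f i j := by
  by_contra! h
  have h0 : ∀ i j, f.1.1 i * f.1.2 j = f.1.1 j * f.1.2 i := fun i j ↦ by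
    have h1 := h i j
    have h2 := h j i
    simp only [pluecker] at h1 h2
    linarith
  have hf := LinearIndependent.pair_iff.1 f.2
  obtain ⟨i, hi⟩ : ∃ i, f.1.1 i ≠ 0 := by
    by_contra! hz
    have : f.1.1 = 0 := by
      ext i
      exact hz i
    have := hf 1 0 (by simp [this])
    norm_num at this
  refine hi (neg_eq_zero.1 (hf (f.1.2 i) (-f.1.1 i) ?_).2)
  ext j
  simp only [PiLp.add_apply, PiLp.smul_apply, smul_eq_mul, PiLp.zero_apply]
  linarith [h0 i j]

/-- The frame `g` is obtained from `f` by a matrix with positive determinant. -/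
def LinFrames.Rel (f g : LinFrames d) : Prop :=
  ∃ a b c e : ℝ, 0 < a * e - b * c ∧
    g.1 = (a • f.1.1 + b • f.1.2, c • f.1.1 + e • f.1.2)

theorem LinFrames.Rel.pluecker_eq {f g : LinFrames d} (h : f.Rel g) :
    ∃ r : ℝ, 0 < r ∧ pluecker g = r • pluecker f := by
  obtain ⟨a, b, c, e, hD, h⟩ := h
  refine ⟨_, hD, ?_⟩
  ext i j
  simp only [pluecker, h, PiLp.add_apply, PiLp.smul_apply, smul_eq_mul, Pi.smul_apply]
  ring

/-- The frame of the plane of `f` whose `i`-th and `j`-th coordinates are standard. -/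
def normalFrame (i j : Fin d) (f : LinFrames d) :
    EuclideanSpace ℝ (Fin d) × EuclideanSpace ℝ (Fin d) :=
  ((pluecker f i j)⁻¹ • (f.1.2 j • f.1.1 - f.1.1 j • f.1.2),
    (pluecker f i j)⁻¹ • (f.1.1 i • f.1.2 - f.1.2 i • f.1.1))

/-- Hence `normalFrame` descends to a section over the planes with positive `(i, j)` coordinate. -/
theorem LinFrames.Rel.normalFrame_eq {f g : LinFrames d} (h : f.Rel g) (i j : Fin d) :
    normalFrame i j g = normalFrame i j f := by
  obtain ⟨a, b, c, e, hD, h⟩ := h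
  have hp : pluecker g i j = (a * e - b * c) * pluecker f i j := by
    simp only [pluecker, h, PiLp.add_apply, PiLp.smul_apply, smul_eq_mul]
    ring
  have hD' := hD.ne'
  rw [normalFrame, normalFrame, hp, mul_inv]
  refine Prod.ext ?_ ?_
  · rw [← smul_right_inj hD', smul_smul, ← mul_assoc, mul_inv_cancel₀ hD', one_mul,
      smul_comm (a * e - b * c)]
    congr 1
    simp only [h, PiLp.add_apply, PiLp.smul_apply, smul_eq_mul]
    module
  · rw [← smul_right_inj hD', smul_smul, ← mul_assoc, mul_inv_cancel₀ hD', one_mul,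
      smul_comm (a * e - b * c)]
    congr 1
    simp only [h, PiLp.add_apply, PiLp.smul_apply, smul_eq_mul]
    module

theorem continuousAt_normalFrame (i j : Fin d) {f : LinFrames d} (h : pluecker f i j ≠ 0) :
    ContinuousAt (normalFrame i j) f := by
  have hp : ContinuousAt (fun g : LinFrames d ↦ (pluecker g i j)⁻¹) f :=
    ContinuousAt.inv₀ (by have := continuous_pluecker (d := d); fun_prop) h
  unfold normalFrame
  refine ContinuousAt.prodMk (hp.smul (Continuous.continuousAt ?_))
    (hp.smul (Continuous.continuousAt ?_)) <;> fun_prop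

/-- The frame with the same `i`-th and `j`-th coordinates as `f` in the plane of a normalized
frame `s`. -/
def combineFrame (i j : Fin d) (f s : EuclideanSpace ℝ (Fin d) × EuclideanSpace ℝ (Fin d)) :
    EuclideanSpace ℝ (Fin d) × EuclideanSpace ℝ (Fin d) :=
  (f.1 i • s.1 + f.1 j • s.2, f.2 i • s.1 + f.2 j • s.2)

theorem continuous_combineFrame (i j : Fin d) :
    Continuous fun z : (EuclideanSpace ℝ (Fin d) × EuclideanSpace ℝ (Fin d)) ×
      (EuclideanSpace ℝ (Fin d) × EuclideanSpace ℝ (Fin d)) ↦ combineFrame i j z.1 z.2 := by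
  unfold combineFrame
  fun_prop

theorem combineFrame_self (i j : Fin d) {f : LinFrames d} (h : pluecker f i j ≠ 0) :
    combineFrame i j f.1 (normalFrame i j f) = f.1 := by
  have key : ∀ v : EuclideanSpace ℝ (Fin d),
      (pluecker f i j)⁻¹ • (pluecker f i j • v) = v := inv_smul_smul₀ h
  refine Prod.ext ?_ ?_
  · rw [← key f.1.1]
    simp only [combineFrame, normalFrame]
    rw [smul_comm (f.1.1 i), smul_comm (f.1.1 j), ← smul_add]
    congr 1
    simp only [pluecker]
    module
  · rw [← key f.1.2]
    simp only [combineFrame, normalFrame]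
    rw [smul_comm (f.1.2 i), smul_comm (f.1.2 j), ← smul_add]
    congr 1
    simp only [pluecker]
    module

theorem combineFrame_eq (i j : Fin d) (f g : LinFrames d) :
    combineFrame i j f.1 (normalFrame i j g) =
      (((pluecker g i j)⁻¹ * (f.1.1 i * g.1.2 j - f.1.1 j * g.1.2 i)) • g.1.1 +
        ((pluecker g i j)⁻¹ * (f.1.1 j * g.1.1 i - f.1.1 i * g.1.1 j)) • g.1.2,
      ((pluecker g i j)⁻¹ * (f.1.2 i * g.1.2 j - f.1.2 j * g.1.2 i)) • g.1.1 +
        ((pluecker g i j)⁻¹ * (f.1.2 j * g.1.1 i - f.1.2 i * g.1.1 j)) • g.1.2) := by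
  refine Prod.ext ?_ ?_ <;> simp only [combineFrame, normalFrame] <;> module

/-- The determinant is the quotient of the Plücker coordinates of `f` and `g`, so the orientation of
the plane of `g` is kept. -/
theorem combineFrame_det (i j : Fin d) {f g : LinFrames d} (hf : 0 < pluecker f i j)
    (hg : 0 < pluecker g i j) :
    0 < ((pluecker g i j)⁻¹ * (f.1.1 i * g.1.2 j - f.1.1 j * g.1.2 i)) *
          ((pluecker g i j)⁻¹ * (f.1.2 j * g.1.1 i - f.1.2 i * g.1.1 j)) -
        ((pluecker g i j)⁻¹ * (f.1.1 j * g.1.1 i - f.1.1 i * g.1.1 j)) *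
          ((pluecker g i j)⁻¹ * (f.1.2 i * g.1.2 j - f.1.2 j * g.1.2 i)) := by
  have : ((pluecker g i j)⁻¹ * (f.1.1 i * g.1.2 j - f.1.1 j * g.1.2 i)) *
          ((pluecker g i j)⁻¹ * (f.1.2 j * g.1.1 i - f.1.2 i * g.1.1 j)) -
        ((pluecker g i j)⁻¹ * (f.1.1 j * g.1.1 i - f.1.1 i * g.1.1 j)) *
          ((pluecker g i j)⁻¹ * (f.1.2 i * g.1.2 j - f.1.2 j * g.1.2 i)) =
      (pluecker g i j)⁻¹ * (pluecker g i j)⁻¹ * (pluecker f i j * pluecker g i j) := by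
    simp only [pluecker]
    ring
  rw [this]
  positivity

theorem LinFrames.exists_rel_eq (g : LinFrames d) {a b c e : ℝ} (hD : 0 < a * e - b * c) :
    ∃ g' : LinFrames d, g'.1 = (a • g.1.1 + b • g.1.2, c • g.1.1 + e • g.1.2) ∧ g.Rel g' :=
  ⟨⟨(a • g.1.1 + b • g.1.2, c • g.1.1 + e • g.1.2), linearIndependent_pair_change g.2 hD⟩, rfl,
    a, b, c, e, hD, rfl⟩

theorem exists_eq_combineFrame (i j : Fin d) {f g : LinFrames d} (hf : 0 < pluecker f i j)
    (hg : 0 < pluecker g i j) :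
    ∃ g' : LinFrames d, g'.1 = combineFrame i j f.1 (normalFrame i j g) ∧ g.Rel g' := by
  rw [combineFrame_eq]
  exact g.exists_rel_eq (combineFrame_det i j hf hg)

variable {B : Type v} [TopologicalSpace B] {p : LinFrames d → B}

/-- Homotopies lift to frames over planes with a fixed positive Plücker coordinate. -/
theorem hasLiftsOver_pluecker (hp : IsOpenQuotientMap p) (hrel : ∀ f g, p f = p g ↔ f.Rel g)
    (i j : Fin d) {A : Set B} (hA : ∀ f, p f ∈ A → 0 < pluecker f i j) :
    HasLiftsOver.{0, v, w} p A := by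
  let s : B → EuclideanSpace ℝ (Fin d) × EuclideanSpace ℝ (Fin d) := fun P ↦
    normalFrame i j (Function.surjInv hp.surjective P)
  have hs : ∀ f, s (p f) = normalFrame i j f := fun f ↦
    ((hrel _ _).1 (Function.surjInv_eq hp.surjective (p f)).symm).normalFrame_eq i j
  have hsc : ∀ P ∈ A, ContinuousAt s P := by
    intro P hP
    obtain ⟨f, rfl⟩ := hp.surjective P
    rw [← hp.continuousAt_comp_iff]
    exact (continuousAt_normalFrame i j (hA f hP).ne').congr (.of_forall fun g ↦ (hs g).symm)
  clear_value s
  intro Y _ H f hf hH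
  have hfpos : ∀ y, 0 < pluecker (f y) i j := fun y ↦ hA _ (by rw [hf]; exact hH _)
  -- The lift keeps the `i`-th and `j`-th coordinates of the initial frame and takes the remaining
  -- ones from the moving plane.
  have hG : ∀ z : Y × I, ∃ g : LinFrames d,
      g.1 = combineFrame i j (f z.1).1 (s (H z)) ∧ p g = H z := by
    intro z
    obtain ⟨g, hg⟩ := hp.surjective (H z)
    have hgpos : 0 < pluecker g i j := hA _ (by rw [hg]; exact hH z)
    obtain ⟨g', h₁, h₂⟩ := exists_eq_combineFrame i j (hfpos z.1) hgpos
    exact ⟨g', by rw [h₁, ← hg, hs], by rw [← hg, eq_comm, hrel]; exact h₂⟩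
  choose G hG₁ hG₂ using hG
  refine ⟨⟨G, ?_⟩, fun y ↦ Subtype.ext ?_, hG₂⟩
  · refine LinFrames.continuous_of_val ?_
    have hsH : Continuous fun z ↦ s (H z) :=
      continuous_iff_continuousAt.2 fun z ↦
        ContinuousAt.comp (hsc _ (hH z)) H.continuous.continuousAt
    simp only [hG₁]
    exact (continuous_combineFrame i j).comp (Continuous.prodMk (by fun_prop) hsH)
  · change (G (y, 0)).1 = _
    rw [hG₁, ← hf, hs, combineFrame_self i j (hfpos y).ne']

/-- The map from frames to oriented planes has the homotopy lifting property. -/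
theorem hasLiftsOver_linFrames (hp : IsOpenQuotientMap p) (hrel : ∀ f g, p f = p g ↔ f.Rel g) :
    HasLiftsOver.{0, v, w} p Set.univ := by
  -- Normalized Plücker vectors map the planes to a separable metrizable space `N`, covered by the
  -- sets where one coordinate is positive. Normalization removes the positive determinant by which
  -- frames of one plane differ.
  let N : Type := {z : Fin d → Fin d → ℝ // ∃ i j, 0 < z i j}
  have hpos : ∀ f : LinFrames d, 0 < ‖pluecker f‖ := fun f ↦ by
    rw [norm_pos_iff]
    intro h
    obtain ⟨i, j, hij⟩ := exists_pluecker_pos f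
    simp [h] at hij
  let nf : C(LinFrames d, N) := ⟨fun f ↦ ⟨‖pluecker f‖⁻¹ • pluecker f, by
      obtain ⟨i, j, hij⟩ := exists_pluecker_pos f
      exact ⟨i, j, mul_pos (inv_pos.2 (hpos f)) hij⟩⟩, by
    exact Continuous.subtype_mk ((continuous_pluecker.norm.inv₀ fun f ↦ (hpos f).ne').smul
      continuous_pluecker) _⟩
  have hfac : Function.FactorsThrough nf p := by
    intro f g hfg
    obtain ⟨r, hr, h⟩ := ((hrel f g).1 hfg).pluecker_eq
    refine Subtype.ext ?_
    change ‖pluecker f‖⁻¹ • pluecker f = ‖pluecker g‖⁻¹ • pluecker g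
    rw [h, norm_smul, smul_smul, Real.norm_of_nonneg hr.le, mul_inv, mul_assoc,
      mul_comm _ r, ← mul_assoc, inv_mul_cancel₀ hr.ne', one_mul]
  let ψ : C(B, N) := Topology.IsQuotientMap.lift (f := ⟨p, hp.continuous⟩) hp.isQuotientMap nf hfac
  have hψ : ∀ f, ψ (p f) = nf f := fun f ↦ by
    have := Topology.IsQuotientMap.lift_comp (f := ⟨p, hp.continuous⟩) hp.isQuotientMap nf hfac
    exact DFunLike.congr_fun this f
  refine HasLiftsOver.of_local ψ fun z ↦ ?_
  obtain ⟨i, j, hij⟩ := z.2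
  refine ⟨{z : N | 0 < z.1 i j}, ?_, hij, hasLiftsOver_pluecker hp hrel i j fun f hf ↦ ?_⟩
  · exact isOpen_lt continuous_const
      ((continuous_apply_apply i j).comp continuous_subtype_val)
  · change 0 < (ψ (p f)).1 i j at hf
    rw [hψ] at hf
    exact (mul_pos_iff_of_pos_left (inv_pos.2 (hpos f))).1 hf

variable {M : Type u} [TopologicalSpace M] [ChartedSpace (EuclideanSpace ℝ (Fin d)) M]

/-- A frame of the tangent space at `x`. -/
def frameAt (x : M) (f : LinFrames d) : TwoFrames d M := ⟨⟨x, f.1⟩, f.2⟩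

/-- The oriented plane in the tangent space at `x` spanned by a frame. -/
def fiberSpan (x : M) (f : LinFrames d) : {P : OrientedGrassmannian d M // P.proj = x} :=
  ⟨orientedSpan (frameAt x f), rfl⟩

theorem fiberSpan_eq_iff (x : M) (f g : LinFrames d) : fiberSpan x f = fiberSpan x g ↔ f.Rel g := by
  rw [Subtype.ext_iff]
  constructor
  · intro h
    obtain ⟨a, b, c, e, hD, h⟩ : SameOrientedPlane d M (frameAt x f) (frameAt x g) :=
      Quotient.exact h
    exact ⟨a, b, c, e, hD, eq_of_heq (TotalSpace.mk.inj h).2⟩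
  · rintro ⟨a, b, c, e, hD, h⟩
    refine Quotient.sound (⟨a, b, c, e, hD, ?_⟩ : SameOrientedPlane d M (frameAt x f) (frameAt x g))
    exact congrArg (TotalSpace.mk x) h

variable [IsManifold (𝓡 d) ∞ M]

theorem isInducing_frameAt (x : M) :
    Topology.IsInducing (frameAt x : LinFrames d → TwoFrames d M) := by
  refine (Topology.IsInducing.of_comp_iff (f := frameAt x)
    (Topology.IsInducing.subtypeVal (t := {f : TangentPairs d M |
      LinearIndependent ℝ ![f.2.1, f.2.2]}))).1 ?_
  exact (FiberBundle.totalSpaceMk_isInducing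
    (EuclideanSpace ℝ (Fin d) × EuclideanSpace ℝ (Fin d))
    ((TangentSpace (𝓡 d) : M → Type) ×ᵇ (TangentSpace (𝓡 d) : M → Type)) x).comp
      Topology.IsInducing.subtypeVal

theorem exists_frameAt_eq {x : M} {P : OrientedGrassmannian d M} (h : P.proj = x) :
    ∃ f : LinFrames d, orientedSpan (frameAt x f) = P := by
  obtain ⟨⟨⟨y, f⟩, hf⟩, rfl⟩ := isOpenQuotientMap_orientedSpan.surjective P
  obtain rfl : y = x := h
  exact ⟨⟨f, hf⟩, rfl⟩

/-- The frames at `x` form the full preimage of the fiber, and an open quotient map restricts to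
such a set. -/
theorem isOpenQuotientMap_fiberSpan (x : M) : IsOpenQuotientMap (fiberSpan (d := d) x) := by
  refine ⟨?_, ?_, ?_⟩
  · rintro ⟨P, hP⟩
    obtain ⟨f, rfl⟩ := exists_frameAt_eq hP
    exact ⟨f, rfl⟩
  · exact Continuous.subtype_mk (isOpenQuotientMap_orientedSpan.continuous.comp
      (isInducing_frameAt x).continuous) _
  · intro O hO
    obtain ⟨O', hO', rfl⟩ := (isInducing_frameAt x).isOpen_iff.1 hO
    refine ⟨orientedSpan '' O', isOpenQuotientMap_orientedSpan.isOpenMap _ hO', ?_⟩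
    ext ⟨P, hP⟩
    constructor
    · rintro ⟨⟨⟨y, f⟩, hf⟩, hfO, hfP⟩
      obtain rfl : y = x := by
        rw [← hP]
        exact congrArg OrientedGrassmannian.proj hfP
      exact ⟨⟨f, hf⟩, hfO, Subtype.ext hfP⟩
    · rintro ⟨f, hf, hfP⟩
      exact ⟨frameAt x f, hf, congrArg Subtype.val hfP⟩

theorem hasLiftsOver_fiberSpan (x : M) :
    HasLiftsOver.{0, u, w} (fiberSpan (d := d) x) Set.univ :=
  hasLiftsOver_linFrames (isOpenQuotientMap_fiberSpan x) (fiberSpan_eq_iff x)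

/-- Changing the frame multiplies the value of the form by a positive determinant, so one frame
decides. -/
theorem orientedSpan_frameAt_mem_symplecticPlanes_iff (β : NondegenerateTwoForm d M) (x : M)
    (f : LinFrames d) :
    orientedSpan (frameAt x f) ∈ SymplecticPlanes β ↔ 0 < β.form x f.1.1 f.1.2 := by
  refine ⟨?_, fun h ↦ ⟨frameAt x f, h, rfl⟩⟩
  rintro ⟨⟨⟨y, g⟩, hg⟩, hpos, hgf⟩
  obtain rfl : y = x := congrArg OrientedGrassmannian.proj hgf
  obtain ⟨a, b, c, e, hD, h⟩ : LinFrames.Rel ⟨g, hg⟩ f :=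
    (fiberSpan_eq_iff y ⟨g, hg⟩ f).1 (Subtype.ext hgf)
  let η : EuclideanSpace ℝ (Fin d) →L[ℝ] EuclideanSpace ℝ (Fin d) →L[ℝ] ℝ := β.form y
  have halt : ∀ v, η v v = 0 := β.alternating y
  have hpos : 0 < η g.1 g.2 := hpos
  change 0 < η f.1.1 f.1.2
  have : η f.1.1 f.1.2 = (a * e - b * c) * η g.1 g.2 := by
    rw [h]
    simp only [map_add, map_smul, add_apply, smul_apply, smul_eq_mul, halt,
      alternating_swap halt g.2 g.1]
    ring
  rw [this]
  positivity

end LinearFrames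

/-! ### General position by Hausdorff dimension. -/

noncomputable section GeneralPosition

/-- **General position**: a continuous map can be changed away from a compact set, so as to miss a
closed set of large codimension. -/
theorem exists_continuous_avoiding {ι X W P : Type*} [Countable ι]
    [NormedAddCommGroup X] [NormedSpace ℝ X] [FiniteDimensional ℝ X]
    [NormedAddCommGroup W] [NormedSpace ℝ W] [FiniteDimensional ℝ W]
    [NormedAddCommGroup P] [NormedSpace ℝ P] [FiniteDimensional ℝ P]
    {Z : Set W} (hZ : IsClosed Z) {φ : ι → P → W} (hφ : ∀ i, ContDiff ℝ 1 (φ i))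
    (hZφ : Z ⊆ ⋃ i, Set.range (φ i))
    (hdim : Module.finrank ℝ X + Module.finrank ℝ P < Module.finrank ℝ W)
    {F : X → W} (hF : Continuous F) {S : Set X} (hS : IsCompact S) (hFS : ∀ x ∈ S, F x ∉ Z) :
    ∃ G : X → W, Continuous G ∧ (∀ x ∈ S, G x = F x) ∧ ∀ x, G x ∉ Z := by
  rcases Z.eq_empty_or_nonempty with rfl | hZne
  · exact ⟨F, hF, fun _ _ ↦ rfl, fun _ ↦ Set.notMem_empty _⟩
  let D : X → ℝ := fun x ↦ Metric.infDist (F x) Z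
  have hD : Continuous D := (Metric.continuous_infDist_pt Z).comp hF
  -- Compactness keeps `F` at distance at least `2 * δ` from `Z` on `S`. Replace `F` by a smooth `g`
  -- within `δ / 2` and translate it by a generic `w` shorter than `δ / 2`; the result `u` misses
  -- `Z`.
  obtain ⟨δ, hδ, hδS⟩ : ∃ δ > 0, ∀ x ∈ S, 2 * δ ≤ D x := by
    rcases S.eq_empty_or_nonempty with rfl | hSne
    · exact ⟨1, one_pos, by simp⟩
    · obtain ⟨x, hx, hmin⟩ := hS.exists_isMinOn hSne hD.continuousOn
      refine ⟨D x / 2, half_pos ((hZ.notMem_iff_infDist_pos hZne).1 (hFS x hx)), fun y hy ↦ ?_⟩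
      rw [mul_div_cancel₀ _ two_ne_zero]
      exact hmin hy
  obtain ⟨g, hg⟩ := exists_contMDiffMap_forall_mem_convex_of_local_const (n := 1) 𝓘(ℝ, X)
    (t := fun x ↦ Metric.ball (F x) (δ / 2)) (fun x ↦ convex_ball _ _) (fun x ↦ ⟨F x, by
      filter_upwards [hF.continuousAt.eventually (Metric.ball_mem_nhds (F x) (half_pos hδ))]
        with y hy
      exact Metric.mem_ball_comm.1 hy⟩)
  have hgs : ContDiff ℝ 1 g := contMDiff_iff_contDiff.1 (by simpa using g.contMDiff)
  -- The translations that make `g` hit `Z` lie in a countable union of `C¹` images of `X × P`,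
  -- whose Hausdorff dimension is too small to contain an open set.
  have hdense : Dense (⋃ i, Set.range fun z : X × P ↦ φ i z.2 - g z.1)ᶜ := by
    refine dense_compl_of_dimH_lt_finrank ?_
    rw [dimH_iUnion]
    have hle : ∀ i, dimH (Set.range fun z : X × P ↦ φ i z.2 - g z.1) ≤
        (Module.finrank ℝ X + Module.finrank ℝ P : ℕ) := by
      intro i
      rw [← Module.finrank_prod]
      exact ContDiff.dimH_range_le
        (((hφ i).comp contDiff_snd).sub (hgs.comp contDiff_fst))
    exact (iSup_le hle).trans_lt (by exact_mod_cast hdim)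
  obtain ⟨w, hw, hwδ⟩ := hdense.exists_dist_lt 0 (half_pos hδ)
  rw [dist_zero_left] at hwδ
  let u : X → W := fun x ↦ g x + w
  have huc : Continuous u := hgs.continuous.add continuous_const
  have huZ : ∀ x, u x ∉ Z := by
    intro x hx
    obtain ⟨i, p, hp⟩ := Set.mem_iUnion.1 (hZφ hx)
    refine hw (Set.mem_iUnion.2 ⟨i, (x, p), ?_⟩)
    simp only [hp, u, add_sub_cancel_left]
  have huF : ∀ x, ‖u x - F x‖ < δ := by
    intro x
    have h1 : ‖g x - F x‖ < δ / 2 := by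
      rw [← dist_eq_norm]
      exact hg x
    calc ‖u x - F x‖ = ‖(g x - F x) + w‖ := by simp only [u]; congr 1; abel
      _ ≤ ‖g x - F x‖ + ‖w‖ := norm_add_le _ _
      _ < δ := by linarith
  -- The cutoff is `1` within distance `δ` of `Z` and `0` beyond `2 * δ`. Where `D x > δ` the map
  -- moves by less than `δ`, hence cannot reach `Z`.
  let θ : X → ℝ := fun x ↦ min 1 (max 0 (2 - D x / δ))
  have hθ : Continuous θ := by fun_prop
  have hθ0 : ∀ x, 0 ≤ θ x := fun x ↦ le_min zero_le_one (le_max_left _ _)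
  have hθ1 : ∀ x, θ x ≤ 1 := fun x ↦ min_le_left _ _
  refine ⟨fun x ↦ F x + θ x • (u x - F x), by fun_prop, fun x hx ↦ ?_, fun x ↦ ?_⟩
  · have : θ x = 0 := by
      have : 2 - D x / δ ≤ 0 := by
        rw [sub_nonpos, le_div_iff₀ hδ]
        exact hδS x hx
      simp only [θ, max_eq_left this, min_eq_right zero_le_one]
    simp [this]
  · rcases le_or_gt (D x) δ with h | h
    · have : θ x = 1 := by
        have : 1 ≤ 2 - D x / δ := by
          have := (div_le_one hδ).2 h
          linarith
        exact min_eq_left (this.trans (le_max_right _ _))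
      simpa [this] using huZ x
    · intro hmem
      have h1 := Metric.infDist_le_dist_of_mem (x := F x) hmem
      rw [dist_self_add_right, norm_smul, Real.norm_of_nonneg (hθ0 x)] at h1
      have h2 : θ x * ‖u x - F x‖ ≤ 1 * ‖u x - F x‖ :=
        mul_le_mul_of_nonneg_right (hθ1 x) (norm_nonneg _)
      have h3 := huF x
      have h4 : D x ≤ θ x * ‖u x - F x‖ := h1
      linarith

variable {d : ℕ}

local notation "E" => EuclideanSpace ℝ (Fin d)

/-- Maps from a space of dimension less than `d - 1` into `ℝ^d × ℝ^d` can be pushed off the set of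
dependent pairs, relative to a compact set. -/
theorem exists_continuous_linearIndependent {X : Type*}
    [NormedAddCommGroup X] [NormedSpace ℝ X] [FiniteDimensional ℝ X]
    (hdim : Module.finrank ℝ X + 1 < d) {F : X → E × E} (hF : Continuous F) {S : Set X}
    (hS : IsCompact S) (hFS : ∀ x ∈ S, LinearIndependent ℝ ![(F x).1, (F x).2]) :
    ∃ G : X → LinFrames d, Continuous G ∧ ∀ x ∈ S, (G x).1 = F x := by
  let Z : Set (E × E) := {f | ¬ LinearIndependent ℝ ![f.1, f.2]}
  have hZ : IsClosed Z := by
    rw [← isOpen_compl_iff]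
    have : Zᶜ = (fun f : E × E ↦ ![f.1, f.2]) ⁻¹' {f | LinearIndependent ℝ f} := by
      ext f
      simp [Z]
    rw [this]
    refine isOpen_setOfPred_linearIndependent.preimage ?_
    refine continuous_pi fun i ↦ ?_
    fin_cases i
    · exact continuous_fst
    · exact continuous_snd
  -- In a dependent pair one vector is a multiple of the other: two families of dimension `d + 1` in
  -- dimension `2 * d`.
  let φ : Bool → ℝ × E → E × E := fun b z ↦ if b then (z.2, z.1 • z.2) else (z.1 • z.2, z.2)
  have hφ : ∀ b, ContDiff ℝ 1 (φ b) := by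
    rintro (_ | _)
    · exact (contDiff_fst.smul contDiff_snd).prodMk contDiff_snd
    · exact contDiff_snd.prodMk (contDiff_fst.smul contDiff_snd)
  have hZφ : Z ⊆ ⋃ b, Set.range (φ b) := by
    rintro ⟨v, w⟩ hf
    have hf : ¬ LinearIndependent ℝ ![v, w] := hf
    rw [LinearIndependent.pair_iff] at hf
    push Not at hf
    obtain ⟨s, t, hst, hne⟩ := hf
    rw [Set.mem_iUnion]
    by_cases hs : s = 0
    · have ht : t ≠ 0 := hne hs
      refine ⟨true, (-s / t, v), Prod.ext rfl ?_⟩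
      have : w = t⁻¹ • (t • w) := (inv_smul_smul₀ ht w).symm
      rw [this, eq_neg_of_add_eq_zero_right hst]
      simp only [φ, if_true]
      module
    · refine ⟨false, (-t / s, w), Prod.ext ?_ rfl⟩
      have : v = s⁻¹ • (s • v) := (inv_smul_smul₀ hs v).symm
      rw [this, eq_neg_of_add_eq_zero_left hst]
      simp only [φ, Bool.false_eq_true, if_false]
      module
  obtain ⟨G, hG, hGF, hGZ⟩ := exists_continuous_avoiding hZ hφ hZφ (by
    simp only [Module.finrank_prod, Module.finrank_self, finrank_euclideanSpace_fin]
    omega) hF hS (fun x hx h ↦ h (hFS x hx))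
  exact ⟨fun x ↦ ⟨G x, not_not.1 (hGZ x)⟩, LinFrames.continuous_of_val hG, hGF⟩

theorem linearIndependent_of_form_pos {η : E →L[ℝ] E →L[ℝ] ℝ} (hη : ∀ v, η v v = 0) {v w : E}
    (h : 0 < η v w) : LinearIndependent ℝ ![v, w] := by
  rw [LinearIndependent.pair_iff]
  intro s t hst
  constructor
  · have : η (s • v + t • w) w = 0 := by rw [hst]; simp
    simpa [hη, h.ne'] using this
  · have : η v (s • v + t • w) = 0 := by rw [hst]; simp
    simpa [hη, h.ne'] using this

/-- The vector that represents the functional `η v`. -/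
def formDual (η : E →L[ℝ] E →L[ℝ] ℝ) (v : E) : E := (InnerProductSpace.toDual ℝ E).symm (η v)

theorem continuous_formDual (η : E →L[ℝ] E →L[ℝ] ℝ) : Continuous (formDual η) := by
  unfold formDual
  fun_prop

theorem form_formDual_pos {η : E →L[ℝ] E →L[ℝ] ℝ} (hnd : ∀ v, (∀ w, η v w = 0) → v = 0) {v : E}
    (hv : v ≠ 0) : 0 < η v (formDual η v) := by
  have h : ∀ w, η v w = inner ℝ (formDual η v) w := fun w ↦ by
    rw [formDual, InnerProductSpace.toDual_symm_apply]
  rw [h, real_inner_self_pos]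
  intro h0
  exact hv (hnd v fun w ↦ by rw [h, h0, inner_zero_left])

/-- Pairs on which a non-degenerate alternating form is positive: maps from a space of dimension
less than `d - 1` can be pushed into this set, relative to a compact set. -/
theorem exists_continuous_form_pos {X : Type*}
    [NormedAddCommGroup X] [NormedSpace ℝ X] [FiniteDimensional ℝ X]
    (hdim : Module.finrank ℝ X + 1 < d) {η : E →L[ℝ] E →L[ℝ] ℝ}
    (hnd : ∀ v, (∀ w, η v w = 0) → v = 0) {F : X → E × E} (hF : Continuous F) {S : Set X}
    (hS : IsCompact S) (hFS : ∀ x ∈ S, 0 < η (F x).1 (F x).2) :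
    ∃ G : X → E × E, Continuous G ∧ (∀ x ∈ S, G x = F x) ∧ ∀ x, 0 < η (G x).1 (G x).2 := by
  -- First make the first vector non-zero. The origin is parametrized by the constant map on `ℝ`, so
  -- that the dimension bound is exactly `hdim`.
  obtain ⟨a, ha, haS, ha0⟩ := exists_continuous_avoiding (ι := Unit) (P := ℝ)
    (isClosed_singleton (x := (0 : E))) (φ := fun _ _ ↦ 0) (fun _ ↦ contDiff_const)
    (by simp) (by simpa using hdim) hF.fst hS (fun x hx h ↦ by
      have := hFS x hx
      rw [show (F x).1 = 0 from h] at this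
      simp at this)
  have hηc : Continuous fun x ↦ η (a x) (F x).2 := by fun_prop
  obtain ⟨δ, hδ, hδS⟩ : ∃ δ > 0, ∀ x ∈ S, δ ≤ η (a x) (F x).2 := by
    rcases S.eq_empty_or_nonempty with rfl | hSne
    · exact ⟨1, one_pos, by simp⟩
    · obtain ⟨x, hx, hmin⟩ := hS.exists_isMinOn hSne hηc.continuousOn
      refine ⟨_, ?_, fun y hy ↦ hmin hy⟩
      change 0 < η (a x) (F x).2
      rw [haS x hx]
      exact hFS x hx
  have hpos : ∀ x, 0 < η (a x) (formDual η (a x)) := fun x ↦ form_formDual_pos hnd (ha0 x)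
  have hdual : Continuous fun x ↦ formDual η (a x) := (continuous_formDual η).comp ha
  -- The coefficient raises the value of the form to `max δ (η (a x) (F x).2)` and vanishes on `S`.
  refine ⟨fun x ↦ (a x, (F x).2 + (max 0 (δ - η (a x) (F x).2) /
    η (a x) (formDual η (a x))) • formDual η (a x)), ?_, fun x hx ↦ ?_, fun x ↦ ?_⟩
  · refine ha.prodMk (hF.snd.add (Continuous.smul (Continuous.div ?_ ?_ fun x ↦ (hpos x).ne')
      hdual)) <;> fun_prop
  · refine Prod.ext (haS x hx) ?_
    simp only [max_eq_left (sub_nonpos.2 (hδS x hx)), zero_div, zero_smul, add_zero]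
  · simp only [map_add, map_smul, smul_eq_mul]
    rw [div_mul_cancel₀ _ (hpos x).ne']
    have := le_max_right 0 (δ - η (a x) (F x).2)
    linarith

end GeneralPosition

/-! ### Connectivity of the fibers. -/

noncomputable section Fiber

variable {d : ℕ}

local notation "E" => EuclideanSpace ℝ (Fin d)

/-- Families of paths of frames with a common starting point and with positive end points, indexed
by a compact space of low dimension, can be deformed to a constant family, relative to a closed set
on which they are already constant. -/
theorem exists_deformation_frames {K X : Type*} [TopologicalSpace K] [CompactSpace K]
    [NormedAddCommGroup X] [NormedSpace ℝ X] [FiniteDimensional ℝ X] (κ : C(K, X)) (ρ : C(X, K))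
    (hρκ : ∀ k, ρ (κ k) = k) (hdim : Module.finrank ℝ X + 3 < d) {η : E →L[ℝ] E →L[ℝ] ℝ}
    (hη : ∀ v, η v v = 0) (hnd : ∀ v, (∀ w, η v w = 0) → v = 0) {T : Set K} (hT : IsClosed T)
    (Φ : C(K × I, LinFrames d)) (γ : C(I, LinFrames d)) (h0 : ∀ k, Φ (k, 0) = γ 0)
    (hΦT : ∀ k ∈ T, ∀ t, Φ (k, t) = γ t) (hΦ1 : ∀ k, 0 < η (Φ (k, 1)).1.1 (Φ (k, 1)).1.2)
    (hγ1 : 0 < η (γ 1).1.1 (γ 1).1.2) :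
    ∃ Ψ : C((I × K) × I, LinFrames d), (∀ k t, Ψ ((0, k), t) = Φ (k, t)) ∧
      (∀ k t, Ψ ((1, k), t) = γ t) ∧ (∀ z, Ψ (z, 0) = γ 0) ∧
      (∀ r, ∀ k ∈ T, ∀ t, Ψ ((r, k), t) = γ t) ∧
      ∀ z, 0 < η (Ψ (z, 1)).1.1 (Ψ (z, 1)).1.2 := by
  let clamp : ℝ → I := Set.projIcc 0 1 zero_le_one
  have hclamp : Continuous clamp := continuous_projIcc
  have hcl : ∀ t : I, clamp t = t := fun t ↦ Set.projIcc_val zero_le_one t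
  -- The linear homotopy from `Φ` to the constant family `γ`, extended to a whole vector space by
  -- the retractions `clamp` and `ρ`. It may pass through dependent pairs and non-positive end
  -- points.
  let A : (ℝ × X) × ℝ → E × E := fun z ↦ (1 - (clamp z.1.1 : ℝ)) • (Φ (ρ z.1.2, clamp z.2)).1 +
    (clamp z.1.1 : ℝ) • (γ (clamp z.2)).1
  have hA : Continuous A := by fun_prop
  let e' : I × K → ℝ × X := fun z ↦ (z.1, κ z.2)
  have he' : Continuous e' := by fun_prop
  let e : (I × K) × I → (ℝ × X) × ℝ := fun z ↦ (e' z.1, z.2)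
  have he : Continuous e := by fun_prop
  have hAe : ∀ r k (t : I), A (e' (r, k), t) =
      (1 - (r : ℝ)) • (Φ (k, t)).1 + (r : ℝ) • (γ t).1 := by
    intro r k t
    simp only [A, e', hcl, hρκ]
  have hA0 : ∀ k (t : I), A (e' (0, k), t) = (Φ (k, t)).1 := fun k t ↦ by simp [hAe]
  have hA1 : ∀ k (t : I), A (e' (1, k), t) = (γ t).1 := fun k t ↦ by simp [hAe]
  have hAT : ∀ r, ∀ k ∈ T, ∀ t : I, A (e' (r, k), t) = (γ t).1 := fun r k hk t ↦ by
    rw [hAe, hΦT k hk, ← add_smul, sub_add_cancel, one_smul]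
  have hAt0 : ∀ r k, A (e' (r, k), (0 : I)) = (γ 0).1 := fun r k ↦ by
    rw [hAe, h0, ← add_smul, sub_add_cancel, one_smul]
  -- The parameters at which the homotopy is prescribed: both ends, and the closed set `T`.
  let S' : Set (I × K) := {z | z.1 = 0 ∨ z.1 = 1 ∨ z.2 ∈ T}
  have hS' : IsClosed S' := (isClosed_eq continuous_fst continuous_const).union
    ((isClosed_eq continuous_fst continuous_const).union (hT.preimage continuous_snd))
  have hAS' : ∀ z ∈ S', ∀ t : I, ∃ k, A (e' z, t) = (Φ (k, t)).1 ∨ A (e' z, t) = (γ t).1 := by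
    rintro ⟨r, k⟩ h t
    refine ⟨k, ?_⟩
    rcases h with h | h | h
    · obtain rfl : r = 0 := h
      exact .inl (hA0 k t)
    · obtain rfl : r = 1 := h
      exact .inr (hA1 k t)
    · exact .inr (hAT r k h t)
  obtain ⟨G', hG', hG'A, hG'pos⟩ := exists_continuous_form_pos (X := ℝ × X) (by
    rw [Module.finrank_prod, Module.finrank_self]
    omega) hnd (F := fun z ↦ A (z, 1)) (by fun_prop) (hS'.isCompact.image he') (by
    rintro _ ⟨z, hz, rfl⟩
    obtain ⟨k, h | h⟩ := hAS' z hz 1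
    · rw [Set.Icc.coe_one] at h
      rw [h]
      exact hΦ1 k
    · rw [Set.Icc.coe_one] at h
      rw [h]
      exact hγ1)
  -- The correction at time `1` is spread linearly over the path, so the start is unchanged.
  -- Avoiding dependent pairs comes second and is relative to times `0` and `1`, which preserves
  -- positivity.
  let B : (ℝ × X) × ℝ → E × E := fun z ↦ A z + (clamp z.2 : ℝ) • (G' z.1 - A (z.1, 1))
  have hB : Continuous B := by fun_prop
  have hBS' : ∀ z ∈ S', ∀ t : I, B (e' z, t) = A (e' z, t) := by
    intro z hz t
    have : G' (e' z) = A (e' z, 1) := hG'A _ ⟨z, hz, rfl⟩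
    simp only [B, this, sub_self, smul_zero, add_zero]
  have hB0 : ∀ z, B (e' z, (0 : I)) = (γ 0).1 := by
    intro z
    have hz : A (e' z, (0 : I)) = (γ 0).1 := hAt0 z.1 z.2
    simp only [B]
    rw [hcl, hz, Set.Icc.coe_zero, zero_smul, add_zero]
  have hB1 : ∀ z, B (e' z, (1 : I)) = G' (e' z) := by
    intro z
    simp only [B]
    rw [hcl, Set.Icc.coe_one, one_smul, add_sub_cancel]
  let S : Set ((I × K) × I) := {z | z.1 ∈ S' ∨ z.2 = 0 ∨ z.2 = 1}
  have hS : IsClosed S := (hS'.preimage continuous_fst).union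
    ((isClosed_eq continuous_snd continuous_const).union
      (isClosed_eq continuous_snd continuous_const))
  obtain ⟨G, hG, hGB⟩ := exists_continuous_linearIndependent (X := (ℝ × X) × ℝ) (by
    rw [Module.finrank_prod, Module.finrank_prod, Module.finrank_self]
    omega) hB (hS.isCompact.image he) (by
    rintro _ ⟨⟨z, t⟩, hz, rfl⟩
    change LinearIndependent ℝ ![(B (e' z, t)).1, (B (e' z, t)).2]
    rcases hz with h | h | h
    · rw [hBS' z h]
      obtain ⟨k, h | h⟩ := hAS' z h t <;> rw [h]
      · exact (Φ (k, t)).2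
      · exact (γ t).2
    · obtain rfl : t = 0 := h
      rw [hB0]
      exact (γ 0).2
    · obtain rfl : t = 1 := h
      rw [hB1]
      exact linearIndependent_of_form_pos hη (hG'pos _))
  have hGB' : ∀ z ∈ S, (G (e z)).1 = B (e' z.1, z.2) := fun z hz ↦ hGB _ ⟨z, hz, rfl⟩
  refine ⟨⟨fun z ↦ G (e z), hG.comp he⟩, fun k t ↦ Subtype.ext ?_, fun k t ↦ Subtype.ext ?_,
    fun z ↦ Subtype.ext ?_, fun r k hk t ↦ Subtype.ext ?_, fun z ↦ ?_⟩
  · have hz : ((0, k) : I × K) ∈ S' := .inl rfl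
    exact (hGB' ((0, k), t) (.inl hz)).trans ((hBS' _ hz t).trans (hA0 k t))
  · have hz : ((1, k) : I × K) ∈ S' := .inr (.inl rfl)
    exact (hGB' ((1, k), t) (.inl hz)).trans ((hBS' _ hz t).trans (hA1 k t))
  · exact (hGB' (z, 0) (.inr (.inl rfl))).trans (hB0 z)
  · have hz : (r, k) ∈ S' := .inr (.inr hk)
    exact (hGB' ((r, k), t) (.inl hz)).trans ((hBS' _ hz t).trans (hAT r k hk t))
  · have h : (G (e (z, 1))).1 = G' (e' z) := (hGB' (z, 1) (.inr (.inr rfl))).trans (hB1 z)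
    change 0 < η (G (e (z, 1))).1.1 (G (e (z, 1))).1.2
    rw [h]
    exact hG'pos _

/-- Every frame can be joined to a frame on which a non-degenerate alternating form is positive. -/
theorem exists_path_to_form_pos (hd : 2 < d) {η : E →L[ℝ] E →L[ℝ] ℝ} (hη : ∀ v, η v v = 0)
    (hnd : ∀ v, (∀ w, η v w = 0) → v = 0) (f : LinFrames d) :
    ∃ γ : C(I, LinFrames d), γ 0 = f ∧ 0 < η (γ 1).1.1 (γ 1).1.2 := by
  have hf : f.1.1 ≠ 0 := f.2.ne_zero 0
  have hpos := form_formDual_pos hnd hf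
  -- Keep the first vector and move the second linearly to its dual vector; general position removes
  -- dependent pairs in between.
  let F : ℝ → E × E := fun t ↦ (f.1.1, (1 - t) • f.1.2 + t • formDual η f.1.1)
  have hF0 : F 0 = f.1 := by simp [F]
  have hF1 : F 1 = (f.1.1, formDual η f.1.1) := by simp [F]
  obtain ⟨G, hG, hGF⟩ := exists_continuous_linearIndependent (X := ℝ) (by
    rw [Module.finrank_self]
    omega) (F := F) (by fun_prop) (S := {0, 1}) ((Set.finite_singleton _).insert _).isCompact (by
    rintro x (rfl | rfl)
    · rw [hF0]
      exact f.2
    · rw [hF1]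
      exact linearIndependent_of_form_pos hη hpos)
  refine ⟨⟨fun t ↦ G t, by fun_prop⟩, Subtype.ext ?_, ?_⟩
  · simpa [hF0] using hGF 0 (by simp)
  · have h : (G (1 : I)).1 = F 1 := by simpa using hGF 1 (by simp)
    change 0 < η (G (1 : I)).1.1 (G (1 : I)).1.2
    rw [h, hF1]
    exact hpos

variable {M : Type u} [TopologicalSpace M] [ChartedSpace (EuclideanSpace ℝ (Fin d)) M]
  [IsManifold (𝓡 d) ∞ M]

/-- A family of paths of frames at a point `x`, with a fixed starting point and ending in positive
frames, gives a family of paths of planes. -/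
theorem exists_family_of_frames {Z : Type*} [TopologicalSpace Z] (β : NondegenerateTwoForm d M)
    {x : M} {f : LinFrames d} (Ψ : C(Z × I, LinFrames d)) (h0 : ∀ z, Ψ (z, 0) = f)
    (h1 : ∀ z, 0 < β.form x (Ψ (z, 1)).1.1 (Ψ (z, 1)).1.2) :
    ∃ Γ : C(Z, startingPlane β ⁻¹' {orientedSpan (frameAt x f)}),
      ∀ z t, (Γ z).1.1 t = orientedSpan (frameAt x (Ψ (z, t))) := by
  have hc : Continuous fun z ↦ orientedSpan (frameAt x (Ψ z)) :=
    isOpenQuotientMap_orientedSpan.continuous.comp ((isInducing_frameAt x).continuous.comp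
      Ψ.continuous)
  refine ⟨⟨fun z ↦ ⟨⟨⟨fun t ↦ orientedSpan (frameAt x (Ψ (z, t))), hc.comp (by fun_prop)⟩,
    (orientedSpan_frameAt_mem_symplecticPlanes_iff β x _).2 (h1 z), fun s t ↦ rfl⟩, ?_⟩, ?_⟩,
    fun z t ↦ rfl⟩
  · change orientedSpan (frameAt x (Ψ (z, 0))) = _
    rw [h0]
  · refine Continuous.subtype_mk (Continuous.subtype_mk ?_ _) _
    exact (ContinuousMap.curry ⟨fun z ↦ orientedSpan (frameAt x (Ψ z)), hc⟩).continuous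

/-- The paths of planes starting at a given plane lift to paths of frames, continuously. -/
theorem exists_lift_to_frames (β : NondegenerateTwoForm d M) (x : M) (f : LinFrames d) :
    ∃ L : C((startingPlane β ⁻¹' {orientedSpan (frameAt x f)}) × I, LinFrames d),
      (∀ γ, L (γ, 0) = f) ∧ (∀ γ t, orientedSpan (frameAt x (L (γ, t))) = γ.1.1 t) ∧
        ∀ γ, 0 < β.form x (L (γ, 1)).1.1 (L (γ, 1)).1.2 := by
  have hstart : ∀ γ : startingPlane β ⁻¹' {orientedSpan (frameAt x f)},
      γ.1.1 0 = orientedSpan (frameAt x f) := fun γ ↦ γ.2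
  have hproj : ∀ (γ : startingPlane β ⁻¹' {orientedSpan (frameAt x f)}) t,
      (γ.1.1 t).proj = x := fun γ t ↦ by
    rw [γ.1.2.2 t 0, hstart]
    rfl
  -- The fiber itself serves as parameter space and evaluation as the homotopy, so one application
  -- lifts all paths continuously.
  obtain ⟨L, hL0, hL⟩ := hasLiftsOver_fiberSpan x (startingPlane β ⁻¹' {orientedSpan (frameAt x f)})
    ⟨fun z ↦ ⟨z.1.1.1 z.2, hproj z.1 z.2⟩, by fun_prop⟩ (ContinuousMap.const _ f)
    (fun γ ↦ Subtype.ext (hstart γ).symm) (fun _ ↦ trivial)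
  have hL' : ∀ γ t, orientedSpan (frameAt x (L (γ, t))) = γ.1.1 t :=
    fun γ t ↦ congrArg Subtype.val (hL (γ, t))
  refine ⟨L, hL0, hL', fun γ ↦ ?_⟩
  rw [← orientedSpan_frameAt_mem_symplecticPlanes_iff, hL']
  exact γ.1.2.1

theorem isClosed_cube_boundary (i : ℕ) : IsClosed (Cube.boundary (Fin i)) := by
  have : Cube.boundary (Fin i) = ⋃ j, {y : Fin i → I | y j = 0 ∨ y j = 1} := by
    ext y
    simp [Cube.boundary]
  rw [this]
  exact isClosed_iUnion_of_finite fun j ↦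
    (isClosed_eq (by fun_prop) continuous_const).union (isClosed_eq (by fun_prop) continuous_const)

/-- Lift a loop to frames, contract it there relative to the boundary of the cube, and project back
to planes. Contracting to the lift of `γ₀` yields the constant loop. -/
theorem subsingleton_homotopyGroup_fiber (β : NondegenerateTwoForm d M) (x : M) (f : LinFrames d)
    {i : ℕ} (hi : i + 3 < d) (γ₀ : startingPlane β ⁻¹' {orientedSpan (frameAt x f)}) :
    Subsingleton (HomotopyGroup.Pi i (startingPlane β ⁻¹' {orientedSpan (frameAt x f)}) γ₀) := by
  obtain ⟨L, hL0, hL, hLpos⟩ := exists_lift_to_frames β x f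
  let κ : C(Fin i → I, Fin i → ℝ) := ⟨fun y j ↦ y j, by fun_prop⟩
  -- Coordinatewise clamping retracts `ℝ^i` onto the cube.
  let ρ : C(Fin i → ℝ, Fin i → I) :=
    ⟨fun y j ↦ Set.projIcc 0 1 zero_le_one (y j), continuous_pi fun j ↦
      continuous_projIcc.comp (continuous_apply j)⟩
  have hρκ : ∀ k, ρ (κ k) = k := fun k ↦ funext fun j ↦ Set.projIcc_val zero_le_one (k j)
  have key : ∀ g : GenLoop (Fin i) (startingPlane β ⁻¹' {orientedSpan (frameAt x f)}) γ₀,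
      GenLoop.Homotopic g GenLoop.const := by
    intro g
    obtain ⟨Ψ, hΨ0, hΨ1, hΨ, hΨT, hΨpos⟩ := exists_deformation_frames κ ρ hρκ
      (by simpa using hi) (η := β.form x) (β.alternating x) (β.nondegenerate x)
      (isClosed_cube_boundary i) (L.comp ⟨fun z ↦ (g z.1, z.2), by fun_prop⟩)
      (L.comp ⟨fun t ↦ (γ₀, t), by fun_prop⟩) (fun k ↦ (hL0 _).trans (hL0 _).symm)
      (fun k hk t ↦ congrArg (fun y ↦ L (y, t)) (g.2 k hk)) (fun k ↦ hLpos _) (hLpos _)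
    obtain ⟨Γ, hΓ⟩ := exists_family_of_frames β (x := x) (f := f) Ψ
      (fun z ↦ (hΨ z).trans (hL0 _)) hΨpos
    refine ⟨⟨⟨Γ, fun k ↦ ?_, fun k ↦ ?_⟩, fun r k hk ↦ ?_⟩⟩
    · refine Subtype.ext (Subtype.ext (ContinuousMap.ext fun t ↦ ?_))
      exact (hΓ (0, k) t).trans (by rw [hΨ0]; exact hL (g k) t)
    · refine Subtype.ext (Subtype.ext (ContinuousMap.ext fun t ↦ ?_))
      exact (hΓ (1, k) t).trans (by rw [hΨ1]; exact hL γ₀ t)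
    · refine (Subtype.ext (Subtype.ext (ContinuousMap.ext fun t ↦ ?_)) : Γ (r, k) = γ₀).trans
        (g.2 k hk).symm
      exact (hΓ (r, k) t).trans (by rw [hΨT r k hk]; exact hL γ₀ t)
  refine ⟨fun a b ↦ ?_⟩
  induction a using Quotient.inductionOn with | _ a => ?_
  induction b using Quotient.inductionOn with | _ b => ?_
  exact Quotient.sound ((key a).trans (key b).symm)

theorem simplyConnectedSpace_of_isKConnected {X : Type*} [TopologicalSpace X]
    (h : IsKConnected 1 X) : SimplyConnectedSpace X := by
  obtain ⟨⟨x₀⟩, h⟩ := h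
  rw [simply_connected_iff_loops_nullhomotopic, pathConnectedSpace_iff_zerothHomotopy]
  refine ⟨⟨⟨Quotient.mk _ x₀⟩, ?_⟩, fun x γ ↦ ?_⟩
  · have := h 0 zero_le_one x₀
    exact (HomotopyGroup.pi0EquivZerothHomotopy (x := x₀)).symm.subsingleton
  · have := h 1 le_rfl x
    have hs : Subsingleton (FundamentalGroup X x) :=
      HomotopyGroup.pi1EquivFundamentalGroup.symm.subsingleton
    have hs' : Subsingleton (Path.Homotopic.Quotient x x) := hs
    exact Quotient.exact (Subsingleton.elim (α := Path.Homotopic.Quotient x x)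
      (Quotient.mk _ γ) (Quotient.mk _ (Path.refl x)))

/-- The bound `6 ≤ d` is what `i + 3 < d` requires at `i = 2`; non-emptiness needs only `2 < d`. -/
theorem isKConnected_fiber_startingPlane (hd : 6 ≤ d) (β : NondegenerateTwoForm d M)
    (P : OrientedGrassmannian d M) : IsKConnected 2 (startingPlane β ⁻¹' {P}) := by
  obtain ⟨x, hx⟩ : ∃ x, P.proj = x := ⟨_, rfl⟩
  obtain ⟨f, rfl⟩ := exists_frameAt_eq hx
  refine ⟨?_, fun i hi γ ↦ subsingleton_homotopyGroup_fiber β _ f (by omega) γ⟩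
  obtain ⟨γ, hγ0, hγ1⟩ := exists_path_to_form_pos (by omega) (η := β.form x)
    (β.alternating _) (β.nondegenerate _) f
  obtain ⟨Γ, -⟩ := exists_family_of_frames β (x := x) (f := f) (Z := Unit)
    (γ.comp ⟨Prod.snd, continuous_snd⟩) (fun _ ↦ hγ0) (fun _ ↦ hγ1)
  exact ⟨Γ ()⟩

end Fiber

theorem mainTheorem12 (n : ℕ) (hn : 6 ≤ 2 * n)
    (M : Type u) [TopologicalSpace M] [T2Space M] [SecondCountableTopology M]
    [ChartedSpace (EuclideanSpace ℝ (Fin (2 * n))) M] [IsManifold (𝓡 (2 * n)) ∞ M]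
    (β : NondegenerateTwoForm (2 * n) M) :
    IsHurewiczFibration.{u, u, w} (startingPlane β) ∧
      ∀ P : OrientedGrassmannian (2 * n) M,
        IsKConnected 2 (startingPlane β ⁻¹' {P}) ∧
          SimplyConnectedSpace (startingPlane β ⁻¹' {P}) := by
  refine ⟨isHurewiczFibration_startingPlane β, fun P ↦ ?_⟩
  have h := isKConnected_fiber_startingPlane hn β P
  exact ⟨h, simplyConnectedSpace_of_isKConnected ⟨h.1, fun i hi ↦ h.2 i (hi.trans one_le_two)⟩⟩
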